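/- Let $K\ge 2$ and let $\mathcal T$ be the regular rooted tree in which the root $0$ has $K$ neighbours and every other vertex has $K+1$ neighbours; $|x|$ denotes the graph distance of $x$ to $0$. Let $V(x)$, $x\in\mathcal T$, be independent, identically distributed real random variables whose common law has a bounded density $\varrho$ with respect to Lebesgue measure such that $\int |v|^r\varrho(v)\,dv<\infty$ for some $r>12$ and, for some $c<\infty$, $\varrho(v)\le c\,\inf_{0<\nu\le 1}\frac1{2\nu}\int_{|v'-v|<\nu}\varrho(v')\,dv'$ for Lebesgue-almost every $v$. Let $H$ be the self-adjoint operator on $\ell^2(\mathcal T)$ given by $(H\psi)(x)=-\sum_{y\sim x}\psi(y)+V(x)\psi(x)$ on its maximal domain, let $G(x,y;\zeta)=\langle\delta_x,(H-\zeta)^{-1}\delta_y\rangle$ for $\operatorname{Im}\zeta>0$, and let $$\varphi(s;\zeta)=\lim_{|x|\to\infty}\frac1{|x|}\log\mathbb E\big[|G(0,x;\zeta)|^s\big].$$ Suppose that for some bounded measurable set $I\subset\mathbb R$ and some $\delta>0$ $$\operatorname*{ess\,sup}_{\zeta\in I+i(0,1]}\mathbb E\big[(\operatorname{Im}G(0,0;\zeta))^{-3-\delta}\big]<\infty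 .$$ Then there are constants $C_\pm\in(0,\infty)$, which do not depend on $E$, $\eta$ or $x$, such that for almost every $E\in I$, all $\eta\in(0,1]$ and $\zeta=E+i\eta$ the following holds: the limit defining $\varphi(2;\zeta)$ exists and is finite, and for all $x\in\mathcal T$ $$C_-\,e^{\varphi(2;\zeta)|x|}\le\mathbb E\big[|G(0,x;\zeta)|^2\big]\le C_+\,e^{\varphi(2;\zeta)|x|};$$ moreover $\varphi(2;\zeta)\le-\log K$ and hence $\mathbb E\big[|G(0,x;\zeta)|^2\big]\le C_+\,K^{-|x|}$ for all $x\in\mathcal T$. -/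

import Mathlib

open MeasureTheory ProbabilityTheory Filter Topology Set
open scoped ENNReal

noncomputable section

namespace RandomTree

/-! ### Schrödinger operators on graphs and their Green functions -/

/-- The complex Hilbert space `ℓ²(T)` of square-summable functions on `T`. -/
abbrev L2 (T : Type*) : Type _ := lp (fun _ : T => ℂ) 2

/-- The action of `H` on functions: `(Hψ)(x) = - ∑_{y adjacent to x} ψ(y) + V(x) ψ(x)`. -/
def formalH {T : Type*} (G : SimpleGraph T) [G.LocallyFinite] (V : T → ℝ) (ψ : T → ℂ) : T → ℂ :=
  fun x => -(∑ y ∈ G.neighborFinset x, ψ y) + (V x : ℂ) * ψ x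

theorem formalH_add {T : Type*} (G : SimpleGraph T) [G.LocallyFinite] (V : T → ℝ)
    (ψ χ : T → ℂ) : formalH G V (ψ + χ) = formalH G V ψ + formalH G V χ := by
  funext x
  simp only [formalH, Pi.add_apply, Finset.sum_add_distrib]
  ring

theorem formalH_smul {T : Type*} (G : SimpleGraph T) [G.LocallyFinite] (V : T → ℝ)
    (c : ℂ) (ψ : T → ℂ) : formalH G V (c • ψ) = c • formalH G V ψ := by
  funext x
  simp only [formalH, Pi.smul_apply, smul_eq_mul, ← Finset.mul_sum]
  ring

/-- The Schrödinger operator with potential `V` on its maximal domain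
`{ψ ∈ ℓ² : Hψ ∈ ℓ²}`.  If the vertex degrees are bounded, the hopping term is a bounded operator,
so this domain is `{ψ ∈ ℓ² : Vψ ∈ ℓ²}`, on which the operator is self-adjoint. -/
def schrodinger {T : Type*} (G : SimpleGraph T) [G.LocallyFinite] (V : T → ℝ) :
    L2 T →ₗ.[ℂ] L2 T where
  domain :=
    { carrier := {ψ | Memℓp (formalH G V ψ) 2}
      add_mem' := by
        intro ψ χ hψ hχ
        simp only [Set.mem_ofPred_eq, lp.coeFn_add, formalH_add] at *
        exact hψ.add hχ
      zero_mem' := by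
        have h : formalH G V (0 : T → ℂ) = 0 := by funext x; simp [formalH]
        simp only [Set.mem_ofPred_eq, lp.coeFn_zero, h]
        exact zero_memℓp
      smul_mem' := by
        intro c ψ hψ
        simp only [Set.mem_ofPred_eq, lp.coeFn_smul, formalH_smul] at *
        exact hψ.const_smul c }
  toFun :=
    { toFun := fun ψ => ⟨formalH G V (ψ : L2 T), ψ.2⟩
      map_add' := by
        intro ψ χ
        exact Subtype.ext (formalH_add G V _ _)
      map_smul' := by
        intro c ψ
        exact Subtype.ext (formalH_smul G V _ _) }

/-- `R` is the bounded two-sided inverse of `H - ζ`, for a partially defined operator `H`. -/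
def IsResolventAt {E : Type*} [NormedAddCommGroup E] [NormedSpace ℂ E]
    (H : E →ₗ.[ℂ] E) (ζ : ℂ) (R : E →L[ℂ] E) : Prop :=
  (∀ ψ : E, ∃ h : R ψ ∈ H.domain, H ⟨R ψ, h⟩ - ζ • R ψ = ψ) ∧
    ∀ ψ : H.domain, R (H ψ - ζ • (ψ : E)) = ψ

theorem IsResolventAt.unique {E : Type*} [NormedAddCommGroup E] [NormedSpace ℂ E]
    {H : E →ₗ.[ℂ] E} {ζ : ℂ} {R S : E →L[ℂ] E}
    (hR : IsResolventAt H ζ R) (hS : IsResolventAt H ζ S) : R = S := by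
  ext ψ
  obtain ⟨h, hψ⟩ := hS.1 ψ
  simpa only [hψ] using hR.2 ⟨S ψ, h⟩

open Classical in
/-- The resolvent `(H - ζ)⁻¹`; it is `0` by convention if `ζ` is not in the resolvent set. -/
def resolventAt {E : Type*} [NormedAddCommGroup E] [NormedSpace ℂ E]
    (H : E →ₗ.[ℂ] E) (ζ : ℂ) : E →L[ℂ] E :=
  if h : ∃ R : E →L[ℂ] E, IsResolventAt H ζ R then h.choose else 0

open Classical in
/-- The normalized function `δ_x` localized at `x`. -/
def delta {T : Type*} (x : T) : L2 T := lp.single 2 x (1 : ℂ)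

/-- The Green function `G(x, y; ζ) = ⟨δ_x, (H - ζ)⁻¹ δ_y⟩`. -/
def green {T : Type*} (G : SimpleGraph T) [G.LocallyFinite] (V : T → ℝ) (x y : T) (ζ : ℂ) : ℂ :=
  inner ℂ (delta x) (resolventAt (schrodinger G V) ζ (delta y))

/-! ### The regular rooted tree -/

/-- The vertices of the regular rooted tree with branching number `K`: finite words over an
alphabet with `K` letters.  The children of `x` are the words `i :: x`. -/
abbrev Vertex (K : ℕ) : Type := List (Fin K)

/-- The root of the tree. -/
abbrev root (K : ℕ) : Vertex K := []

/-- The regular rooted tree: every vertex is joined to each of its `K` children.  The root has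
`K` neighbours and every other vertex has `K + 1`. -/
def tree (K : ℕ) : SimpleGraph (Vertex K) where
  Adj x y := (∃ i, y = i :: x) ∨ ∃ i, x = i :: y
  symm := ⟨fun _ _ h => h.symm⟩
  loopless := ⟨by
    rintro x (⟨i, h⟩ | ⟨i, h⟩) <;> simp at h⟩

theorem tree_neighborSet_finite (K : ℕ) (x : Vertex K) : ((tree K).neighborSet x).Finite := by
  refine ((Set.finite_range (fun i : Fin K => i :: x)).union
    (Set.finite_singleton x.tail)).subset ?_
  rintro y (⟨i, rfl⟩ | ⟨i, rfl⟩)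
  · exact Or.inl ⟨i, rfl⟩
  · exact Or.inr rfl

instance tree_locallyFinite (K : ℕ) : (tree K).LocallyFinite :=
  fun x => (tree_neighborSet_finite K x).fintype

/-- `|x|`, the graph distance of `x` to the root. -/
def depth {K : ℕ} (x : Vertex K) : ℕ := (tree K).dist (root K) x

/-! ### The random potential -/

/-- The conditions on the single-site density `ϱ`: it is a nonnegative, essentially bounded,
measurable function with a finite absolute moment of some order `r > 12`, and almost everywhere
`ϱ(v) ≤ c inf_{0 < ν ≤ 1} (2ν)⁻¹ ∫_{|v' - v| < ν} ϱ(v') dv'` for some finite `c`. -/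
structure IsAdmissibleDensity (ρ : ℝ → ℝ) : Prop where
  measurable : Measurable ρ
  nonneg : ∀ v, 0 ≤ ρ v
  bounded : ∃ M : ℝ, ∀ᵐ v, ρ v ≤ M
  moment : ∃ r : ℝ, 12 < r ∧ Integrable (fun v : ℝ => |v| ^ r * ρ v)
  local_bound : ∃ c : ℝ, ∀ᵐ v : ℝ, ∀ ν ∈ Ioc (0 : ℝ) 1,
    ρ v ≤ c * ((2 * ν)⁻¹ * ∫ v' in Metric.ball v ν, ρ v')

/-- `V(x)`, `x ∈ T`, are independent, identically distributed random variables whose common law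
has the density `ρ` with respect to Lebesgue measure. -/
structure IsIIDPotential {T Ω : Type*} [MeasurableSpace Ω] (P : Measure Ω) (V : T → Ω → ℝ)
    (ρ : ℝ → ℝ) : Prop where
  measurable : ∀ x, Measurable (V x)
  indep : iIndepFun V P
  law : ∀ x, P.map (V x) = volume.withDensity (fun v => ENNReal.ofReal (ρ v))

/-- The random Green function `G(x, y; ζ)` of the Schrödinger operator on the tree. -/
def randomGreen {K : ℕ} {Ω : Type*} (V : Vertex K → Ω → ℝ) (x y : Vertex K) (ζ : ℂ) (ω : Ω) : ℂ :=
  green (tree K) (fun z => V z ω) x y ζ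

/-- The moment `𝔼[|G(0, x; ζ)|^s]`. -/
def greenMoment {K : ℕ} {Ω : Type*} [MeasurableSpace Ω] (P : Measure Ω) (V : Vertex K → Ω → ℝ)
    (s : ℝ) (ζ : ℂ) (x : Vertex K) : ℝ :=
  ∫ ω, ‖randomGreen V (root K) x ζ ω‖ ^ s ∂P

/-- The quantity `|x|⁻¹ log 𝔼[|G(0, x; ζ)|^s]`. -/
def logMomentRate {K : ℕ} {Ω : Type*} [MeasurableSpace Ω] (P : Measure Ω) (V : Vertex K → Ω → ℝ)
    (s : ℝ) (ζ : ℂ) (x : Vertex K) : ℝ :=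
  Real.log (greenMoment P V s ζ x) / (depth x : ℝ)

/-- The filter `|x| → ∞` on the vertices of the tree. -/
def depthAtTop (K : ℕ) : Filter (Vertex K) := comap depth atTop

/-- The large-deviation free-energy function
`φ(s; ζ) = lim_{|x| → ∞} |x|⁻¹ log 𝔼[|G(0, x; ζ)|^s]`. -/
def freeEnergy {K : ℕ} {Ω : Type*} [MeasurableSpace Ω] (P : Measure Ω) (V : Vertex K → Ω → ℝ)
    (s : ℝ) (ζ : ℂ) : ℝ :=
  limUnder (depthAtTop K) (logMomentRate P V s ζ)

end RandomTree

end

open RandomTree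

/-!
Write `γ(V)` for the Green function `G(0, 0; ζ)` and `V_i` for the potential on the subtree of the
`i`-th child of the root.  Restricting the equation `(H - ζ) ψ = δ_0` to that subtree gives
`γ(V) = (V(0) - ζ - ∑ i, γ(V_i))⁻¹` and factorizes `G(0, x; ζ)` into the product of the diagonal
Green functions of the subtrees met on the way from the root to `x` (`greenCol_root`,
`greenCol_append_singleton`).  For an i.i.d. potential, `K - 1` of the branches at each vertex of the
path are independent of everything further along it.  With `α` the law of `a = V(0) - ζ - S`, where
`S` is the sum of these `K - 1` side branches, `𝔼|G(0, x; ζ)|²` is therefore the integral of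
`T ^ (|x| + 1) 1` against the law of `γ`, for the transfer operator
`(T f)(b) = ∫ |a - b|⁻² f((a - b)⁻¹) dα(a)` (`lintegral_greenCol_sq`).

The two-sided bound says that the total masses `q n = T ^ n 1 (0)` are multiplicative up to constants
that are uniform in `ζ`; Fekete's lemma then supplies the exponent (`exists_exp_bounds`).  Products of
Möbius maps can be expanded from either end, which yields
`T ^ (n + 1) 1 (b) = ∫ T 1 (b + y) dm_n(y)`, where `m_n` is the image of the point mass at `0` under
the `n`-th power of the dual operator and has mass `q n` (`iterate_transfer_eq_lintegral`).  So an
upper bound on `T 1`, a lower bound of the form `c (1 + |b|)⁻²`, and the fact that at least half of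
`T 1` comes from values `|(a - b)⁻¹| ≤ R` are enough (`TransferBounds`).

The upper bound holds because the density is bounded, so that the average over the potential is a
Poisson integral of size `1 / Im S`.  For the third bound, a large value needs a small `Im S` and a
potential within distance one of a point `t`; the local condition on the density compares the
corresponding contribution with the probability of a ball around `t`, hence with `T 1` itself, up to
the factor `(1 + |S|)² 1_{Im S < 1/R} / Im S` (`lintegral_large_le`).  Its expectation is small for
large `R` because `𝔼|S|⁴` and `𝔼 (Im S)⁻³` are bounded, and `𝔼|γ|⁴` is itself controlled by
`𝔼 (Im γ)⁻³` (`lintegral_rootGreen_pow_four_le`).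

The exponent is at most `-log K` since `∑ x, |G(0, x; ζ)|² ≤ (Im ζ)⁻²` (`rate_le_neg_log`).  The moment
hypothesis, which is assumed for almost every `ζ`, extends to all `η` for almost every `E` by Fubini's
theorem, continuity of `γ` in `ζ` and Fatou's lemma.
-/

noncomputable section

namespace RandomTree

section

/-! ### Bounded operators on `ℓ²` and the hopping operator of the tree -/

theorem two_toReal_pos : 0 < (2 : ℝ≥0∞).toReal := by norm_num

theorem norm_sq_eq_tsum {T : Type*} (ψ : L2 T) : ‖ψ‖ ^ 2 = ∑' x, ‖ψ x‖ ^ 2 := by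
  have h := lp.norm_rpow_eq_tsum two_toReal_pos ψ
  simpa using h

theorem summable_norm_sq {T : Type*} (ψ : L2 T) : Summable fun x => ‖ψ x‖ ^ 2 := by
  have h := (memℓp_gen_iff two_toReal_pos).1 (lp.memℓp ψ)
  simpa using h

theorem memlp_two_iff {T : Type*} {f : T → ℂ} :
    Memℓp f 2 ↔ Summable fun x => ‖f x‖ ^ 2 := by
  rw [memℓp_gen_iff two_toReal_pos]
  simp

/-- Multiplication by a bounded function, as an operator on `ℓ²(T)`. -/
def mulOp {T : Type*} (d : T → ℂ) (C : ℝ) (h : ∀ x, ‖d x‖ ≤ C) : L2 T →L[ℂ] L2 T :=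
  LinearMap.mkContinuous
    { toFun := fun ψ => ⟨fun x => d x * ψ x, by
        refine memlp_two_iff.2 (Summable.of_nonneg_of_le (fun x => by positivity) (fun x => ?_)
          ((summable_norm_sq ψ).mul_left (C ^ 2)))
        rw [norm_mul, mul_pow]
        gcongr
        exact h x⟩
      map_add' := fun ψ χ => by
        ext x
        exact mul_add _ _ _
      map_smul' := fun c ψ => by
        ext x
        change d x * (c * ψ x) = c * (d x * ψ x)
        ring }
    C (fun ψ => by
      rcases isEmpty_or_nonempty T with hT | ⟨⟨x₀⟩⟩
      · have h1 : ψ = 0 := lp.ext (funext fun x => hT.elim x)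
        subst h1
        rw [map_zero]; simp
      · have hC : 0 ≤ C := (norm_nonneg _).trans (h x₀)
        refine le_of_sq_le_sq ?_ (by positivity)
        rw [mul_pow, norm_sq_eq_tsum, norm_sq_eq_tsum, ← tsum_mul_left]
        refine Summable.tsum_le_tsum (fun x => ?_) (summable_norm_sq _)
          ((summable_norm_sq ψ).mul_left _)
        change ‖d x * ψ x‖ ^ 2 ≤ _
        rw [norm_mul, mul_pow]
        gcongr
        exact h x)

theorem mulOp_apply {T : Type*} (d : T → ℂ) (C : ℝ) (h : ∀ x, ‖d x‖ ≤ C) (ψ : L2 T) (x : T) :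
    mulOp d C h ψ x = d x * ψ x := rfl

theorem norm_mulOp_le {T : Type*} (d : T → ℂ) (C : ℝ) (hC : 0 ≤ C) (h : ∀ x, ‖d x‖ ≤ C) :
    ‖mulOp d C h‖ ≤ C := LinearMap.mkContinuous_norm_le _ hC _

/-- Composition with an injective map, as an operator on `ℓ²`. -/
def compOp {T : Type*} (f : T → T) (hf : Function.Injective f) : L2 T →L[ℂ] L2 T :=
  LinearMap.mkContinuous
    { toFun := fun ψ => ⟨fun x => ψ (f x),
        memlp_two_iff.2 ((summable_norm_sq ψ).comp_injective hf)⟩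
      map_add' := fun ψ χ => by ext x; rfl
      map_smul' := fun c ψ => by ext x; rfl }
    1 (fun ψ => by
      refine le_of_sq_le_sq ?_ (by positivity)
      rw [one_mul, norm_sq_eq_tsum, norm_sq_eq_tsum]
      exact tsum_comp_le_tsum_of_inj (summable_norm_sq ψ) (fun x => by positivity) hf)

theorem compOp_apply {T : Type*} (f : T → T) (hf : Function.Injective f) (ψ : L2 T) (x : T) :
    compOp f hf ψ x = ψ (f x) := rfl

theorem delta_self {T : Type*} (x : T) : delta x x = 1 := by
  classical
  unfold delta
  rw [lp.single_apply_self]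

theorem delta_of_ne {T : Type*} {x y : T} (h : y ≠ x) : delta x y = 0 := by
  classical
  unfold delta
  rw [lp.single_apply_ne _ _ _ h]

theorem delta_apply {T : Type*} [DecidableEq T] (x y : T) :
    delta x y = if y = x then (1 : ℂ) else 0 := by
  split_ifs with h
  · rw [h, delta_self]
  · exact delta_of_ne h

theorem inner_delta_left {T : Type*} (x : T) (ψ : L2 T) : inner ℂ (delta x) ψ = ψ x := by
  classical
  unfold delta
  rw [lp.inner_single_left]
  simp

theorem inner_delta_right {T : Type*} (x : T) (ψ : L2 T) :
    inner ℂ ψ (delta x) = (starRingEnd ℂ) (ψ x) := by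
  rw [← inner_conj_symm, inner_delta_left]

theorem norm_delta {T : Type*} (x : T) : ‖(delta x : L2 T)‖ = 1 := by
  classical
  unfold delta
  rw [lp.norm_single (by norm_num)]
  simp

variable {K : ℕ}

theorem cons_left_injective (i : Fin K) :
    Function.Injective (fun x : Vertex K => i :: x) := fun _ _ h => (List.cons.inj h).2

/-- The sum of a function over the children of a vertex and over its parent. -/
theorem sum_neighborFinset (ψ : Vertex K → ℂ) (x : Vertex K) :
    ∑ y ∈ (tree K).neighborFinset x, ψ y
      = ∑ i : Fin K, (ψ (i :: x) + if x.head? = some i then ψ x.tail else 0) := by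
  classical
  have hset : (tree K).neighborFinset x
      = (Finset.univ.image (fun i : Fin K => i :: x)) ∪ (if x = [] then ∅ else {x.tail}) := by
    ext y
    rw [SimpleGraph.mem_neighborFinset]
    simp only [tree, Finset.mem_union, Finset.mem_image, Finset.mem_univ, true_and]
    cases x with
    | nil => simp [eq_comm]
    | cons j t =>
      simp only [List.cons.injEq, exists_eq_left', reduceCtorEq, if_false,
        Finset.mem_singleton, List.tail_cons]
      constructor
      · rintro (⟨i, h⟩ | h)
        · exact Or.inl ⟨i, h.symm⟩
        · exact Or.inr h.symm
      · rintro (⟨i, h⟩ | h)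
        · exact Or.inl ⟨i, h.symm⟩
        · exact Or.inr h.symm
  rw [hset, Finset.sum_union, Finset.sum_image, Finset.sum_add_distrib]
  · congr 1
    cases x with
    | nil => simp
    | cons j t => simp
  · intro a _ b _ h
    exact (List.cons.inj h).1
  · cases x with
    | nil => simp
    | cons j t =>
      simp only [reduceCtorEq, if_false, Finset.disjoint_singleton_right, Finset.mem_image,
        Finset.mem_univ, true_and, List.tail_cons, not_exists]
      intro i h
      have := congrArg List.length h
      simp at this
      omega

/-- The hopping operator `ψ ↦ ∑_{y ∼ x} ψ(y)` of the tree, assembled from the shifts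
`ψ ↦ ψ(i :: ·)` and their adjoints. -/
def hop (K : ℕ) : L2 (Vertex K) →L[ℂ] L2 (Vertex K) :=
  ∑ i : Fin K, (compOp _ (cons_left_injective i)
    + ContinuousLinearMap.adjoint (compOp _ (cons_left_injective i)))

theorem adjoint_compOp_cons_apply (i : Fin K) (ψ : L2 (Vertex K)) (x : Vertex K) :
    ContinuousLinearMap.adjoint (compOp _ (cons_left_injective i)) ψ x
      = if x.head? = some i then ψ x.tail else 0 := by
  classical
  rw [← inner_delta_left, ContinuousLinearMap.adjoint_inner_right]
  have h : compOp _ (cons_left_injective i) (delta x)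
      = if x.head? = some i then (delta x.tail : L2 (Vertex K)) else 0 := by
    ext y
    rw [compOp_apply, delta_apply]
    cases x with
    | nil => simp
    | cons j t =>
      by_cases hij : i = j
      · subst hij
        simp [delta_apply]
      · have : ¬ j = i := fun h => hij h.symm
        simp [hij, this]
  rw [h]
  split_ifs
  · rw [inner_delta_left]
  · rw [inner_zero_left]

theorem hop_apply (ψ : L2 (Vertex K)) (x : Vertex K) :
    hop K ψ x = ∑ y ∈ (tree K).neighborFinset x, ψ y := by
  rw [sum_neighborFinset, hop]
  simp only [_root_.sum_apply, lp.coeFn_sum, Finset.sum_apply,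
    _root_.add_apply, lp.coeFn_add, Pi.add_apply, adjoint_compOp_cons_apply,
    compOp_apply]

theorem inner_hop_left (ψ χ : L2 (Vertex K)) : inner ℂ (hop K ψ) χ = inner ℂ ψ (hop K χ) := by
  simp only [hop, _root_.sum_apply, _root_.add_apply, sum_inner,
    inner_sum, inner_add_left, inner_add_right, ContinuousLinearMap.adjoint_inner_left,
    ContinuousLinearMap.adjoint_inner_right]
  refine Finset.sum_congr rfl fun i _ => add_comm _ _

end

section

/-! ### Existence of the resolvent -/

variable {K : ℕ}

theorem formalH_eq_sub_hop (V : Vertex K → ℝ) (ψ : L2 (Vertex K)) (x : Vertex K) :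
    formalH (tree K) V ψ x = (V x : ℂ) * ψ x - hop K ψ x := by
  rw [hop_apply, formalH]
  ring

theorem mem_domain_iff (V : Vertex K → ℝ) (ψ : L2 (Vertex K)) :
    ψ ∈ (schrodinger (tree K) V).domain ↔ Memℓp (formalH (tree K) V ψ) 2 := Iff.rfl

theorem schrodinger_apply (V : Vertex K → ℝ) (ψ : (schrodinger (tree K) V).domain)
    (x : Vertex K) :
    schrodinger (tree K) V ψ x = formalH (tree K) V (ψ : L2 (Vertex K)) x := rfl

/-- The operator is symmetric: `H + hop` is multiplication by a real function. -/
theorem inner_schrodinger_left (V : Vertex K → ℝ) (ψ χ : (schrodinger (tree K) V).domain) :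
    inner ℂ (schrodinger (tree K) V ψ) (χ : L2 (Vertex K))
      = inner ℂ (ψ : L2 (Vertex K)) (schrodinger (tree K) V χ) := by
  have key : inner ℂ (schrodinger (tree K) V ψ + hop K ψ) (χ : L2 (Vertex K))
      = inner ℂ (ψ : L2 (Vertex K)) (schrodinger (tree K) V χ + hop K χ) := by
    rw [lp.inner_eq_tsum, lp.inner_eq_tsum]
    refine tsum_congr fun x => ?_
    rw [lp.coeFn_add, lp.coeFn_add, Pi.add_apply, Pi.add_apply, schrodinger_apply,
      schrodinger_apply, formalH_eq_sub_hop, formalH_eq_sub_hop, sub_add_cancel, sub_add_cancel]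
    simp only [RCLike.inner_apply, map_mul, Complex.conj_ofReal]
    ring
  rw [inner_add_left, inner_add_right, inner_hop_left] at key
  exact add_right_cancel key

/-- For `ψ` in the domain, `Im ⟨ψ, (H - ζ) ψ⟩ = - Im ζ ‖ψ‖²`. -/
theorem im_inner_schrodinger_sub (V : Vertex K → ℝ) (ζ : ℂ)
    (ψ : (schrodinger (tree K) V).domain) :
    (inner ℂ (ψ : L2 (Vertex K)) (schrodinger (tree K) V ψ - ζ • (ψ : L2 (Vertex K)))).im
      = - (ζ.im * ‖(ψ : L2 (Vertex K))‖ ^ 2) := by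
  have h1 : (inner ℂ (ψ : L2 (Vertex K)) (schrodinger (tree K) V ψ)).im = 0 := by
    rw [← Complex.conj_eq_iff_im, inner_conj_symm, inner_schrodinger_left]
  rw [inner_sub_right, inner_smul_right, inner_self_eq_norm_sq_to_K, Complex.sub_im, h1]
  change 0 - (ζ * ((‖(ψ : L2 (Vertex K))‖ : ℝ) : ℂ) ^ 2).im = _
  rw [← Complex.ofReal_pow, Complex.im_mul_ofReal, zero_sub]

theorem im_mul_norm_le (V : Vertex K → ℝ) (ζ : ℂ) (hζ : 0 < ζ.im)
    (ψ : (schrodinger (tree K) V).domain) :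
    ζ.im * ‖(ψ : L2 (Vertex K))‖
      ≤ ‖schrodinger (tree K) V ψ - ζ • (ψ : L2 (Vertex K))‖ := by
  rcases eq_or_ne ‖(ψ : L2 (Vertex K))‖ 0 with h | h
  · rw [h, mul_zero]; exact norm_nonneg _
  · have h2 : 0 < ‖(ψ : L2 (Vertex K))‖ := lt_of_le_of_ne (norm_nonneg _) (Ne.symm h)
    have h3 := norm_inner_le_norm (𝕜 := ℂ) (ψ : L2 (Vertex K))
      (schrodinger (tree K) V ψ - ζ • (ψ : L2 (Vertex K)))
    have h4 := Complex.abs_im_le_norm (inner ℂ (ψ : L2 (Vertex K))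
      (schrodinger (tree K) V ψ - ζ • (ψ : L2 (Vertex K))))
    rw [im_inner_schrodinger_sub, abs_neg, abs_of_nonneg (by positivity)] at h4
    nlinarith

theorem IsResolventAt.norm_le {V : Vertex K → ℝ} {ζ : ℂ} (hζ : 0 < ζ.im)
    {R : L2 (Vertex K) →L[ℂ] L2 (Vertex K)} (hR : IsResolventAt (schrodinger (tree K) V) ζ R) :
    ‖R‖ ≤ ζ.im⁻¹ := by
  refine R.opNorm_le_bound (by positivity) fun ψ => ?_
  obtain ⟨h, hψ⟩ := hR.1 ψ
  have := im_mul_norm_le V ζ hζ ⟨R ψ, h⟩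
  rw [hψ] at this
  rw [inv_mul_eq_div, le_div_iff₀ hζ, mul_comm]
  exact this

/-- If `D` inverts `H - ζ` up to the factor `1 - B` with `‖B‖ < 1`, then `D (1 - B)⁻¹` is the
resolvent. -/
theorem exists_isResolventAt_of_approx {E : Type*} [NormedAddCommGroup E] [NormedSpace ℂ E]
    [CompleteSpace E] {H : E →ₗ.[ℂ] E} {ζ : ℂ} (D B : E →L[ℂ] E) (hB : ‖B‖ < 1)
    (h1 : ∀ ψ : E, ∃ h : D ψ ∈ H.domain, H ⟨D ψ, h⟩ - ζ • D ψ = ψ - B ψ)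
    (h2 : ∀ ψ : H.domain, ∃ φ : E, D φ = ψ) :
    ∃ R : E →L[ℂ] E, IsResolventAt H ζ R := by
  set U := Units.oneSub B hB with hU
  have hUv : ∀ φ : E, (U : E →L[ℂ] E) φ = φ - B φ := fun φ => rfl
  have hr : ∀ φ : E, (U : E →L[ℂ] E) ((↑U⁻¹ : E →L[ℂ] E) φ) = φ := fun φ => by
    have := congrArg (fun L : E →L[ℂ] E => L φ) U.mul_inv
    exact this
  have hl : ∀ φ : E, (↑U⁻¹ : E →L[ℂ] E) ((U : E →L[ℂ] E) φ) = φ := fun φ => by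
    have := congrArg (fun L : E →L[ℂ] E => L φ) U.inv_mul
    exact this
  refine ⟨D.comp (↑U⁻¹ : E →L[ℂ] E), fun ψ => ?_, fun ψ => ?_⟩
  · obtain ⟨h, hh⟩ := h1 ((↑U⁻¹ : E →L[ℂ] E) ψ)
    refine ⟨h, ?_⟩
    rw [← hUv, hr] at hh
    exact hh
  · obtain ⟨φ, hφ⟩ := h2 ψ
    obtain ⟨h, hh⟩ := h1 φ
    have h3 : (⟨D φ, h⟩ : H.domain) = ψ := Subtype.ext hφ
    rw [h3, hφ, ← hUv] at hh
    rw [hh, ContinuousLinearMap.comp_apply, hl, hφ]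

/-- High up in the half plane, the hopping operator is a small perturbation of `V - ζ`. -/
theorem exists_isResolventAt_of_norm_hop_lt (V : Vertex K → ℝ) (ζ : ℂ) (hζ : ‖hop K‖ < ζ.im) :
    ∃ R, IsResolventAt (schrodinger (tree K) V) ζ R := by
  have hpos : 0 < ζ.im := (norm_nonneg _).trans_lt hζ
  have hne : ∀ x, (V x : ℂ) - ζ ≠ 0 := fun x h => by
    have := congrArg Complex.im h
    simp at this
    exact hpos.ne' this
  have hd : ∀ x, ‖((V x : ℂ) - ζ)⁻¹‖ ≤ ζ.im⁻¹ := fun x => by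
    rw [norm_inv]
    refine inv_anti₀ hpos ?_
    have := Complex.abs_im_le_norm ((V x : ℂ) - ζ)
    simp only [Complex.sub_im, Complex.ofReal_im, zero_sub, abs_neg] at this
    exact (le_abs_self _).trans this
  set D := mulOp _ _ hd with hD
  have hDn : ‖D‖ ≤ ζ.im⁻¹ := norm_mulOp_le _ _ (by positivity) hd
  have key : ∀ ψ : L2 (Vertex K), ∀ x,
      formalH (tree K) V (D ψ) x = ((ψ - (hop K).comp D ψ) + ζ • D ψ) x := fun ψ x => by
    rw [formalH_eq_sub_hop]
    simp only [lp.coeFn_add, lp.coeFn_sub, Pi.add_apply, Pi.sub_apply, lp.coeFn_smul,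
      Pi.smul_apply, smul_eq_mul, ContinuousLinearMap.comp_apply]
    have : ψ x = ((V x : ℂ) - ζ) * D ψ x := by
      rw [hD, mulOp_apply, mul_inv_cancel_left₀ (hne x)]
    rw [this]; ring
  refine exists_isResolventAt_of_approx D ((hop K).comp D) ?_ (fun ψ => ?_) (fun ψ => ?_)
  · refine (ContinuousLinearMap.opNorm_comp_le _ _).trans_lt ?_
    calc ‖hop K‖ * ‖D‖ ≤ ‖hop K‖ * ζ.im⁻¹ := by gcongr
      _ < 1 := by rw [← div_eq_mul_inv, div_lt_one hpos]; exact hζ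
  · have hm : D ψ ∈ (schrodinger (tree K) V).domain := by
      rw [mem_domain_iff, funext (key ψ)]
      exact lp.memℓp _
    refine ⟨hm, ?_⟩
    rw [sub_eq_iff_eq_add]
    exact lp.ext (funext fun x => by rw [schrodinger_apply]; exact key ψ x)
  · refine ⟨schrodinger (tree K) V ψ + hop K ψ - ζ • (ψ : L2 (Vertex K)), ?_⟩
    refine lp.ext (funext fun x => ?_)
    rw [hD, mulOp_apply]
    simp only [lp.coeFn_add, lp.coeFn_sub, Pi.add_apply, Pi.sub_apply, lp.coeFn_smul,
      Pi.smul_apply, smul_eq_mul]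
    rw [schrodinger_apply, formalH_eq_sub_hop, sub_add_cancel, ← sub_mul,
      inv_mul_cancel_left₀ (hne x)]

/-- The resolvent exists in the upper half plane. The bound `‖(H - ζ₀)⁻¹‖ ≤ 1 / Im ζ₀` lets a single
Neumann series reach every point below `ζ₀`. -/
theorem exists_isResolventAt (V : Vertex K → ℝ) (ζ : ℂ) (hζ : 0 < ζ.im) :
    ∃ R, IsResolventAt (schrodinger (tree K) V) ζ R := by
  -- a spectral parameter with the same real part, high up in the half plane
  set t : ℝ := ‖hop K‖ + 1 with ht
  have htp : 0 < t := by positivity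
  set ζ₀ : ℂ := ζ + t * Complex.I with hζ₀
  have him : ζ₀.im = ζ.im + t := by simp [hζ₀]
  obtain ⟨R, hR⟩ := exists_isResolventAt_of_norm_hop_lt V ζ₀ (by rw [him, ht]; linarith)
  have hRn : ‖R‖ ≤ ζ₀.im⁻¹ := hR.norm_le (by rw [him]; positivity)
  refine exists_isResolventAt_of_approx R ((ζ - ζ₀) • R) ?_ (fun ψ => ?_) (fun ψ => ?_)
  · have h1 : ‖ζ - ζ₀‖ = t := by
      rw [hζ₀, sub_add_cancel_left, norm_neg, norm_mul, Complex.norm_I, mul_one,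
        Complex.norm_real, Real.norm_of_nonneg htp.le]
    rw [norm_smul, h1]
    calc t * ‖R‖ ≤ t * (ζ.im + t)⁻¹ := by rw [← him]; gcongr
      _ < 1 := by rw [← div_eq_mul_inv, div_lt_one (by positivity)]; linarith
  · obtain ⟨h, hh⟩ := hR.1 ψ
    refine ⟨h, ?_⟩
    rw [sub_eq_iff_eq_add] at hh
    rw [hh, _root_.smul_apply, sub_smul]
    abel
  · exact ⟨_, hR.2 ψ⟩

theorem isResolventAt_resolventAt (V : Vertex K → ℝ) (ζ : ℂ) (hζ : 0 < ζ.im) :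
    IsResolventAt (schrodinger (tree K) V) ζ (resolventAt (schrodinger (tree K) V) ζ) := by
  have h := exists_isResolventAt V ζ hζ
  rw [resolventAt, dif_pos h]
  exact h.choose_spec

end

section

/-! ### The Green function with one argument at the root -/

variable {K : ℕ}

/-- The function `x ↦ G(x, 0; ζ)` as an element of `ℓ²`. -/
def greenCol (V : Vertex K → ℝ) (ζ : ℂ) : L2 (Vertex K) :=
  resolventAt (schrodinger (tree K) V) ζ (delta (root K))

theorem formalH_resolventAt (V : Vertex K → ℝ) (ζ : ℂ) (hζ : 0 < ζ.im) (f : L2 (Vertex K))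
    (x : Vertex K) :
    formalH (tree K) V (resolventAt (schrodinger (tree K) V) ζ f) x
      - ζ * resolventAt (schrodinger (tree K) V) ζ f x = f x := by
  obtain ⟨h, hh⟩ := (isResolventAt_resolventAt V ζ hζ).1 f
  have := congrArg (fun ψ : L2 (Vertex K) => ψ x) hh
  simpa only [lp.coeFn_sub, Pi.sub_apply, lp.coeFn_smul, Pi.smul_apply, smul_eq_mul,
    schrodinger_apply] using this

theorem mem_domain_of_formalH_sub_eq {V : Vertex K → ℝ} {ζ : ℂ} {ψ f : L2 (Vertex K)}
    (h : ∀ x, formalH (tree K) V ψ x - ζ * ψ x = f x) :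
    ψ ∈ (schrodinger (tree K) V).domain := by
  rw [mem_domain_iff]
  have : formalH (tree K) V ψ = ⇑(f + ζ • ψ) := by
    funext x
    rw [lp.coeFn_add, Pi.add_apply, lp.coeFn_smul, Pi.smul_apply, smul_eq_mul, ← h x,
      sub_add_cancel]
  rw [this]
  exact lp.memℓp _

theorem schrodinger_sub_eq {V : Vertex K → ℝ} {ζ : ℂ} {ψ f : L2 (Vertex K)}
    (h : ∀ x, formalH (tree K) V ψ x - ζ * ψ x = f x) :
    schrodinger (tree K) V ⟨ψ, mem_domain_of_formalH_sub_eq h⟩ - ζ • ψ = f := by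
  refine lp.ext (funext fun x => ?_)
  rw [lp.coeFn_sub, Pi.sub_apply, lp.coeFn_smul, Pi.smul_apply, smul_eq_mul, ← h x,
    schrodinger_apply]

/-- An `ℓ²` solution of the pointwise equation `(H - ζ) ψ = f` is given by the resolvent. -/
theorem eq_resolventAt {V : Vertex K → ℝ} {ζ : ℂ} (hζ : 0 < ζ.im) {ψ f : L2 (Vertex K)}
    (h : ∀ x, formalH (tree K) V ψ x - ζ * ψ x = f x) :
    ψ = resolventAt (schrodinger (tree K) V) ζ f := by
  have := (isResolventAt_resolventAt V ζ hζ).2 ⟨ψ, mem_domain_of_formalH_sub_eq h⟩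
  rw [schrodinger_sub_eq h] at this
  exact this.symm

theorem formalH_greenCol (V : Vertex K → ℝ) (ζ : ℂ) (hζ : 0 < ζ.im) (x : Vertex K) :
    formalH (tree K) V (greenCol V ζ) x - ζ * greenCol V ζ x = delta (root K) x :=
  formalH_resolventAt V ζ hζ _ x

theorem norm_greenCol_le (V : Vertex K → ℝ) (ζ : ℂ) (hζ : 0 < ζ.im) :
    ‖greenCol V ζ‖ ≤ ζ.im⁻¹ := by
  have := ContinuousLinearMap.le_of_opNorm_le _ ((isResolventAt_resolventAt V ζ hζ).norm_le hζ)
    (delta (root K))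
  rwa [norm_delta, mul_one] at this

/-- `Im G(0, 0; ζ) = Im ζ ∑_x |G(x, 0; ζ)|²`. -/
theorem im_greenCol_root (V : Vertex K → ℝ) (ζ : ℂ) (hζ : 0 < ζ.im) :
    (greenCol V ζ (root K)).im = ζ.im * ‖greenCol V ζ‖ ^ 2 := by
  have h := im_inner_schrodinger_sub V ζ
    ⟨greenCol V ζ, mem_domain_of_formalH_sub_eq (formalH_greenCol V ζ hζ)⟩
  rw [schrodinger_sub_eq (formalH_greenCol V ζ hζ), inner_delta_right, Complex.conj_im] at h
  linarith

theorem im_greenCol_root_pos (V : Vertex K → ℝ) (ζ : ℂ) (hζ : 0 < ζ.im) :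
    0 < (greenCol V ζ (root K)).im := by
  rw [im_greenCol_root V ζ hζ]
  have : greenCol V ζ ≠ 0 := fun h => by
    have h1 := formalH_greenCol V ζ hζ (root K)
    rw [h, delta_self] at h1
    simp [formalH] at h1
  positivity

theorem formalH_star (V : Vertex K → ℝ) (ψ : Vertex K → ℂ) (x : Vertex K) :
    formalH (tree K) V (star ψ) x = star (formalH (tree K) V ψ x) := by
  simp [formalH]

/-- The operator is symmetric for the bilinear pairing, so that `G(0, x; ζ) = G(x, 0; ζ)`. -/
theorem green_root_eq (V : Vertex K → ℝ) (ζ : ℂ) (hζ : 0 < ζ.im) (x : Vertex K) :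
    green (tree K) V (root K) x ζ = greenCol V ζ x := by
  rw [green, inner_delta_left]
  set φ := resolventAt (schrodinger (tree K) V) ζ (delta x) with hφ
  have h1 : ∀ y, formalH (tree K) V φ y - ζ * φ y = delta x y := formalH_resolventAt V ζ hζ _
  have h2 : ∀ y, formalH (tree K) V (star φ : L2 (Vertex K)) y - star ζ * (star φ : L2 (Vertex K)) y
      = delta x y := fun y => by
    rw [lp.coeFn_star, formalH_star, Pi.star_apply, ← star_mul', ← star_sub, h1]
    classical
    rw [delta_apply]
    split_ifs <;> simp
  have h3 := formalH_greenCol V ζ hζ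
  have hsym := inner_schrodinger_left V ⟨star φ, mem_domain_of_formalH_sub_eq h2⟩
    ⟨greenCol V ζ, mem_domain_of_formalH_sub_eq h3⟩
  rw [eq_add_of_sub_eq (schrodinger_sub_eq h2), eq_add_of_sub_eq (schrodinger_sub_eq h3)] at hsym
  simp only [inner_add_left, inner_add_right, inner_smul_left, inner_smul_right,
    inner_delta_left, inner_delta_right] at hsym
  rw [lp.coeFn_star, Pi.star_apply] at hsym
  simp only [Complex.star_def, Complex.conj_conj, add_left_inj] at hsym
  exact hsym.symm

theorem append_singleton_injective (i : Fin K) :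
    Function.Injective (fun l : Vertex K => l ++ [i]) := List.append_left_injective [i]

/-- Restricting `G(·, 0; ζ)` to the subtree of the child `[i]` gives a multiple of the Green
function of the subtree. -/
theorem greenCol_append_singleton (V : Vertex K → ℝ) (ζ : ℂ) (hζ : 0 < ζ.im) (i : Fin K)
    (l : Vertex K) :
    greenCol V ζ (l ++ [i])
      = greenCol V ζ (root K) * greenCol (fun y => V (y ++ [i])) ζ l := by
  set χ : L2 (Vertex K) := compOp _ (append_singleton_injective i) (greenCol V ζ) with hχ
  have h : ∀ x, formalH (tree K) (fun y => V (y ++ [i])) χ x - ζ * χ x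
      = (greenCol V ζ (root K) • (delta (root K) : L2 (Vertex K))) x := fun x => by
    have h1 := formalH_greenCol V ζ hζ (x ++ [i])
    rw [formalH, sum_neighborFinset] at h1 ⊢
    rw [lp.coeFn_smul, Pi.smul_apply, smul_eq_mul]
    simp only [hχ, compOp_apply]
    cases x with
    | nil =>
      rw [delta_self]
      rw [delta_of_ne (by simp)] at h1
      simp only [List.nil_append, List.head?_cons, Option.some.injEq, List.tail_cons,
        List.head?_nil, reduceCtorEq, if_false, Finset.sum_add_distrib, Finset.sum_ite_eq,
        Finset.mem_univ, if_true, List.cons_append, Finset.sum_const_zero] at h1 ⊢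
      linear_combination h1
    | cons j t =>
      rw [delta_of_ne (by simp)]
      rw [delta_of_ne (by simp)] at h1
      simp only [List.cons_append, List.head?_cons, Option.some.injEq, List.tail_cons,
        mul_zero] at h1 ⊢
      exact h1
  have h2 := eq_resolventAt hζ h
  rw [map_smul] at h2
  have h3 := congrArg (fun ψ : L2 (Vertex K) => ψ l) h2
  simp only [lp.coeFn_smul, Pi.smul_apply, smul_eq_mul] at h3
  exact h3

/-- The recursion for the diagonal Green function at the root. -/
theorem greenCol_root (V : Vertex K → ℝ) (ζ : ℂ) (hζ : 0 < ζ.im) :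
    greenCol V ζ (root K)
      = ((V (root K) : ℂ) - ζ - ∑ i, greenCol (fun y => V (y ++ [i])) ζ (root K))⁻¹ := by
  have h1 := formalH_greenCol V ζ hζ (root K)
  rw [formalH, sum_neighborFinset, delta_self] at h1
  have h2 : ∀ i : Fin K, greenCol V ζ [i]
      = greenCol V ζ (root K) * greenCol (fun y => V (y ++ [i])) ζ (root K) := fun i =>
    greenCol_append_singleton V ζ hζ i []
  simp only [List.head?_nil, reduceCtorEq, if_false, add_zero, h2, ← Finset.mul_sum] at h1
  refine eq_inv_of_mul_eq_one_left ?_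
  linear_combination h1

theorem sum_norm_sq_greenCol_le (V : Vertex K → ℝ) (ζ : ℂ) (hζ : 0 < ζ.im)
    (s : Finset (Vertex K)) : ∑ x ∈ s, ‖greenCol V ζ x‖ ^ 2 ≤ (ζ.im⁻¹) ^ 2 := by
  refine ((summable_norm_sq _).sum_le_tsum s fun x _ => by positivity).trans ?_
  rw [← norm_sq_eq_tsum]
  have := norm_greenCol_le V ζ hζ
  gcongr

/-- The Green function depends continuously, for the topology of pointwise convergence, on the
potential and the spectral parameter: it takes values in a compact set, and every limit point
solves the limiting equation, which has only one solution. -/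
theorem continuous_greenCol {X : Type*} [TopologicalSpace X] {v : X → Vertex K → ℝ} {z : X → ℂ}
    (hv : Continuous v) (hz : Continuous z) {η : ℝ} (hη : 0 < η) (hzη : ∀ t, η ≤ (z t).im) :
    Continuous fun t => (greenCol (v t) (z t) : Vertex K → ℂ) := by
  have hpos : ∀ t, 0 < (z t).im := fun t => hη.trans_le (hzη t)
  rw [continuous_iff_ultrafilter]
  intro t g hg
  have hbound : ∀ t, ∀ s : Finset (Vertex K), ∑ x ∈ s, ‖greenCol (v t) (z t) x‖ ^ 2 ≤ (η⁻¹) ^ 2 :=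
    fun t s => (sum_norm_sq_greenCol_le _ _ (hpos t) s).trans (by
      have := hzη t
      have := hpos t
      gcongr)
  have hcomp : IsCompact (Set.pi univ fun _ : Vertex K => Metric.closedBall (0 : ℂ) η⁻¹) :=
    isCompact_univ_pi fun _ => isCompact_closedBall _ _
  obtain ⟨y, -, hy⟩ := hcomp.ultrafilter_le_nhds
    (g.map fun t => (greenCol (v t) (z t) : Vertex K → ℂ)) (by
      rw [le_principal_iff]
      refine Filter.Eventually.of_forall (f := (g : Filter X)) fun t x _ => ?_
      rw [mem_closedBall_zero_iff]
      have := hbound t {x}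
      rw [Finset.sum_singleton] at this
      exact le_of_sq_le_sq this (by positivity))
  have hyt : Tendsto (fun t => (greenCol (v t) (z t) : Vertex K → ℂ)) g (𝓝 y) := hy
  have hyx : ∀ x, Tendsto (fun t => greenCol (v t) (z t) x) g (𝓝 (y x)) :=
    fun x => (tendsto_pi_nhds.1 hyt) x
  have hmem : Memℓp y 2 := by
    rw [memlp_two_iff]
    refine summable_of_sum_le (c := (η⁻¹) ^ 2) (fun x => by positivity) fun s => ?_
    exact le_of_tendsto (tendsto_finsetSum s fun x _ => ((hyx x).norm.pow 2))
      (Filter.Eventually.of_forall fun t => hbound t s)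
  have heq : ∀ x, formalH (tree K) (v t) y x - z t * y x = delta (root K) x := fun x => by
    have hvx : Tendsto (fun t => (v t x : ℂ)) g (𝓝 (v t x : ℂ)) :=
      ((Complex.continuous_ofReal.comp ((continuous_apply x).comp hv)).tendsto t).mono_left hg
    have hzx : Tendsto z g (𝓝 (z t)) := (hz.tendsto t).mono_left hg
    have hl : Tendsto (fun t => formalH (tree K) (v t) (greenCol (v t) (z t)) x
        - z t * greenCol (v t) (z t) x) g (𝓝 (formalH (tree K) (v t) y x - z t * y x)) :=
      (((tendsto_finsetSum _ fun w _ => hyx w).neg.add (hvx.mul (hyx x)))).sub (hzx.mul (hyx x))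
    refine tendsto_nhds_unique hl ?_
    simp only [formalH_greenCol _ _ (hpos _)]
    exact tendsto_const_nhds
  have := eq_resolventAt (hpos t) (ψ := ⟨y, hmem⟩) heq
  have h2 : (greenCol (v t) (z t) : Vertex K → ℂ) = y := by
    rw [greenCol, ← this]
  rw [h2]
  exact hyt

end

section

/-! ### The weighted Möbius transfer operator on the half plane -/

/-- The transfer operator `(Tf)(b) = ∫ |a - b|⁻² f((a - b)⁻¹) dα(a)`. -/
def transfer (α : Measure ℂ) (f : ℂ → ℝ≥0∞) (b : ℂ) : ℝ≥0∞ :=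
  ∫⁻ a, ‖(a - b)⁻¹‖ₑ ^ 2 * f (a - b)⁻¹ ∂α

/-- The action on measures that is dual to `transfer`. -/
def dualTransfer (α m : Measure ℂ) : Measure ℂ :=
  ((m.prod α).withDensity fun p => ‖(p.2 - p.1)⁻¹‖ₑ ^ 2).map fun p => (p.2 - p.1)⁻¹

variable {α : Measure ℂ} [SFinite α]

instance (m : Measure ℂ) [SFinite m] : SFinite (dualTransfer α m) := by
  unfold dualTransfer; infer_instance

instance (m : Measure ℂ) [SFinite m] (n : ℕ) : SFinite ((dualTransfer α)^[n] m) := by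
  induction n with
  | zero => simpa
  | succ n ih => rw [Function.iterate_succ_apply']; infer_instance

@[fun_prop]
theorem measurable_transfer {f : ℂ → ℝ≥0∞} (hf : Measurable f) : Measurable (transfer α f) := by
  unfold transfer
  refine Measurable.lintegral_prod_right' (f := fun p : ℂ × ℂ =>
    ‖(p.2 - p.1)⁻¹‖ₑ ^ 2 * f (p.2 - p.1)⁻¹) ?_
  fun_prop

theorem measurable_iterate_transfer {f : ℂ → ℝ≥0∞} (hf : Measurable f) (n : ℕ) :
    Measurable ((transfer α)^[n] f) := by
  induction n with
  | zero => simpa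
  | succ n ih => rw [Function.iterate_succ_apply']; exact measurable_transfer ih

theorem lintegral_dualTransfer (m : Measure ℂ) [SFinite m] {f : ℂ → ℝ≥0∞} (hf : Measurable f) :
    ∫⁻ y, f y ∂(dualTransfer α m) = ∫⁻ b, transfer α f b ∂m := by
  unfold dualTransfer
  rw [lintegral_map hf (by fun_prop), lintegral_withDensity_eq_lintegral_mul _ (by fun_prop)
    (by fun_prop), lintegral_prod _ (by simp only [Pi.mul_def]; fun_prop)]
  rfl

theorem lintegral_iterate_dualTransfer (m : Measure ℂ) [SFinite m] {f : ℂ → ℝ≥0∞}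
    (hf : Measurable f) (n : ℕ) :
    ∫⁻ y, f y ∂((dualTransfer α)^[n] m) = ∫⁻ b, (transfer α)^[n] f b ∂m := by
  induction n generalizing m with
  | zero => rfl
  | succ n ih =>
    rw [Function.iterate_succ_apply, ih, Function.iterate_succ_apply',
      lintegral_dualTransfer _ (measurable_iterate_transfer hf n)]

theorem im_inv_nonneg {z : ℂ} (hz : z.im ≤ 0) : 0 ≤ z⁻¹.im := by
  rw [Complex.inv_im]
  have := Complex.normSq_nonneg z
  exact div_nonneg (by linarith) this

theorem ae_im_dualTransfer (hα : ∀ᵐ a ∂α, a.im < 0) (m : Measure ℂ) [SFinite m]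
    (hm : ∀ᵐ b ∂m, 0 ≤ b.im) : ∀ᵐ b ∂(dualTransfer α m), 0 ≤ b.im := by
  have hs : MeasurableSet {b : ℂ | ¬ 0 ≤ b.im} :=
    (measurableSet_le measurable_const Complex.measurable_im).compl
  rw [ae_iff, ← lintegral_indicator_one hs, lintegral_dualTransfer _
    (measurable_one.indicator hs), lintegral_eq_zero_iff (measurable_transfer
    (measurable_one.indicator hs))]
  filter_upwards [hm] with b hb
  unfold transfer
  rw [Pi.zero_apply, lintegral_eq_zero_iff
    (by have := (measurable_one (α := ℝ≥0∞)).indicator hs; fun_prop)]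
  filter_upwards [hα] with a ha
  rw [indicator_of_notMem, mul_zero]
  · rfl
  · simp only [mem_ofPred_eq, not_not]
    exact im_inv_nonneg (by rw [Complex.sub_im]; linarith)

theorem ae_im_iterate_dualTransfer (hα : ∀ᵐ a ∂α, a.im < 0) (m : Measure ℂ) [SFinite m]
    (hm : ∀ᵐ b ∂m, 0 ≤ b.im) (n : ℕ) : ∀ᵐ b ∂((dualTransfer α)^[n] m), 0 ≤ b.im := by
  induction n with
  | zero => simpa
  | succ n ih => rw [Function.iterate_succ_apply']; exact ae_im_dualTransfer hα _ ih

/-- The continuant identity behind the reversal symmetry of the transfer operator: both sides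
are `|(a' - y)(a - b) - 1|⁻²`. -/
theorem enorm_continuant_symm {a a' b y : ℂ} (h : a - b ≠ 0) (h' : a' - y ≠ 0) :
    ‖(a - b)⁻¹‖ₑ ^ 2 * ‖(a' - ((a - b)⁻¹ + y))⁻¹‖ₑ ^ 2
      = ‖(a' - y)⁻¹‖ₑ ^ 2 * ‖(a - (b + (a' - y)⁻¹))⁻¹‖ₑ ^ 2 := by
  rw [← mul_pow, ← mul_pow, ← enorm_mul, ← enorm_mul, ← mul_inv, ← mul_inv]
  have : (a - b) * (a' - ((a - b)⁻¹ + y)) = (a' - y) * (a - (b + (a' - y)⁻¹)) := by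
    field_simp
    ring
  rw [this]

/-- The function `T1(b + y)` is symmetric, and applying `T` in the variable `b` or `y` gives the same
result. -/
theorem transfer_translate_symm (hα : ∀ᵐ a ∂α, a.im < 0) {b y : ℂ} (hb : 0 ≤ b.im)
    (hy : 0 ≤ y.im) :
    transfer α (fun u => transfer α 1 (u + y)) b = transfer α (fun u => transfer α 1 (b + u)) y := by
  unfold transfer
  simp only [Pi.one_apply, mul_one]
  simp_rw [← lintegral_const_mul' _ _ (ENNReal.pow_ne_top enorm_ne_top)]
  rw [lintegral_lintegral_swap (by fun_prop)]
  refine lintegral_congr_ae ?_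
  filter_upwards [hα] with a' ha'
  refine lintegral_congr_ae ?_
  filter_upwards [hα] with a ha
  refine enorm_continuant_symm (fun h => ?_) (fun h => ?_)
  · have := congrArg Complex.im h
    rw [Complex.sub_im, Complex.zero_im] at this
    linarith
  · have := congrArg Complex.im h
    rw [Complex.sub_im, Complex.zero_im] at this
    linarith

/-- The iterates of `transfer α` on the constant function, computed from the other end of the
chain. -/
theorem iterate_transfer_eq_lintegral (hα : ∀ᵐ a ∂α, a.im < 0) (n : ℕ) {b : ℂ} (hb : 0 ≤ b.im) :
    (transfer α)^[n + 1] 1 b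
      = ∫⁻ y, transfer α 1 (b + y) ∂((dualTransfer α)^[n] (Measure.dirac 0)) := by
  have hT1 : Measurable (transfer α (1 : ℂ → ℝ≥0∞)) := measurable_transfer measurable_one
  induction n generalizing b with
  | zero => simp [lintegral_dirac]
  | succ n ih =>
    set m := (dualTransfer α)^[n] (Measure.dirac 0) with hm
    have hmi : ∀ᵐ y ∂m, 0 ≤ y.im :=
      ae_im_iterate_dualTransfer hα _ ((ae_dirac_iff
        (measurableSet_le measurable_const Complex.measurable_im)).2 (by simp)) n
    rw [Function.iterate_succ_apply' (transfer α), Function.iterate_succ_apply' (dualTransfer α),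
      lintegral_dualTransfer _ (by fun_prop), ← hm]
    have h1 : transfer α ((transfer α)^[n + 1] 1) b
        = ∫⁻ a, ‖(a - b)⁻¹‖ₑ ^ 2 * ∫⁻ y, transfer α 1 ((a - b)⁻¹ + y) ∂m ∂α := by
      refine lintegral_congr_ae ?_
      filter_upwards [hα] with a ha
      rw [ih (im_inv_nonneg (by rw [Complex.sub_im]; linarith))]
    rw [h1]
    simp_rw [← lintegral_const_mul' _ _ (ENNReal.pow_ne_top enorm_ne_top)]
    rw [lintegral_lintegral_swap (by fun_prop)]
    refine lintegral_congr_ae ?_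
    filter_upwards [hmi] with y hy
    exact transfer_translate_symm hα hb hy

/-- The bounds on a transfer operator that make the products of its iterates comparable: an upper
and a lower bound on `T1`, and a bound on the contribution of large values to `T1`. -/
structure TransferBounds (α : Measure ℂ) (C c R : ℝ≥0∞) : Prop where
  ae_im : ∀ᵐ a ∂α, a.im < 0
  upper : ∀ b : ℂ, 0 ≤ b.im → transfer α 1 b ≤ C
  lower : ∀ b : ℂ, 0 ≤ b.im → c ≤ (1 + ‖b‖ₑ) ^ 2 * transfer α 1 b
  tight : ∀ b : ℂ, 0 ≤ b.im → transfer α 1 b ≤ 2 * transfer α ({u | ‖u‖ₑ ≤ R}.indicator 1) b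

/-- The total mass of the `n`-fold chain started at `0`. -/
def chainMass (α : Measure ℂ) (n : ℕ) : ℝ≥0∞ := (dualTransfer α)^[n] (Measure.dirac 0) univ

theorem measurableSet_enorm_le (R : ℝ≥0∞) : MeasurableSet {u : ℂ | ‖u‖ₑ ≤ R} :=
  measurableSet_le measurable_enorm measurable_const

namespace TransferBounds

variable {C c R : ℝ≥0∞}

theorem chain_im (h : TransferBounds α C c R) (n : ℕ) :
    ∀ᵐ y ∂((dualTransfer α)^[n] (Measure.dirac 0)), 0 ≤ y.im :=
  ae_im_iterate_dualTransfer h.ae_im _ ((ae_dirac_iff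
    (measurableSet_le measurable_const Complex.measurable_im)).2 (by simp)) n

/-- At least half of the mass of each chain measure lies in the ball of radius `R`. -/
theorem chain_tight (h : TransferBounds α C c R) (n : ℕ) :
    chainMass α n ≤ 2 * (dualTransfer α)^[n] (Measure.dirac 0) {u | ‖u‖ₑ ≤ R} := by
  have hs := measurableSet_enorm_le R
  cases n with
  | zero =>
    simp [chainMass, Measure.dirac_apply' _ hs]
  | succ n =>
    have him := h.chain_im n
    rw [chainMass, ← lintegral_indicator_one hs, ← setLIntegral_one, setLIntegral_univ,
      Function.iterate_succ_apply', lintegral_dualTransfer _ (measurable_one.indicator hs),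
      lintegral_dualTransfer _ (by fun_prop), ← lintegral_const_mul _
        (measurable_transfer (measurable_one.indicator hs))]
    refine lintegral_mono_ae ?_
    filter_upwards [him] with b hb
    exact h.tight b hb

/-- Together with `le_iterate`, a Harnack inequality for the iterates: up to constants, their values
at different points agree. -/
theorem iterate_le (h : TransferBounds α C c R) (n : ℕ) {b : ℂ} (hb : 0 ≤ b.im) :
    (transfer α)^[n + 1] 1 b ≤ C * chainMass α n := by
  rw [iterate_transfer_eq_lintegral h.ae_im n hb, chainMass, ← lintegral_const]
  refine lintegral_mono_ae ?_
  filter_upwards [h.chain_im n] with y hy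
  exact h.upper _ (by rw [Complex.add_im]; linarith)

theorem le_iterate (h : TransferBounds α C c R) (n : ℕ) {b : ℂ} (hb : 0 ≤ b.im)
    (hbR : ‖b‖ₑ ≤ R) :
    c * chainMass α n ≤ 2 * (1 + R + R) ^ 2 * (transfer α)^[n + 1] 1 b := by
  have hs := measurableSet_enorm_le R
  have hT1 : Measurable (transfer α (1 : ℂ → ℝ≥0∞)) := measurable_transfer measurable_one
  set m := (dualTransfer α)^[n] (Measure.dirac 0) with hm
  have h1 : c * m {u | ‖u‖ₑ ≤ R} ≤ (1 + R + R) ^ 2 * (transfer α)^[n + 1] 1 b := by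
    rw [iterate_transfer_eq_lintegral h.ae_im n hb, ← setLIntegral_const,
      ← lintegral_const_mul _ (by fun_prop)]
    refine (setLIntegral_mono_ae (by fun_prop) ?_).trans (setLIntegral_le_lintegral _ _)
    filter_upwards [h.chain_im n] with y hy hyR
    -- both `b` and `y` are in the ball of radius `R`
    refine (h.lower (b + y) (by rw [Complex.add_im]; linarith)).trans ?_
    have : ‖b + y‖ₑ ≤ R + R := (enorm_add_le _ _).trans (add_le_add hbR hyR)
    rw [add_assoc]
    gcongr
  calc c * chainMass α n ≤ c * (2 * m {u | ‖u‖ₑ ≤ R}) := by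
        gcongr; exact h.chain_tight n
    _ = 2 * (c * m {u | ‖u‖ₑ ≤ R}) := by ring
    _ ≤ 2 * ((1 + R + R) ^ 2 * (transfer α)^[n + 1] 1 b) := by gcongr
    _ = _ := by ring

theorem lintegral_iterate_le (h : TransferBounds α C c R) (n : ℕ) (m : Measure ℂ)
    (hm : ∀ᵐ b ∂m, 0 ≤ b.im) :
    ∫⁻ b, (transfer α)^[n + 1] 1 b ∂m ≤ C * (chainMass α n * m univ) := by
  rw [← mul_assoc, ← lintegral_const]
  refine lintegral_mono_ae ?_
  filter_upwards [hm] with b hb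
  exact h.iterate_le n hb

theorem le_lintegral_iterate (h : TransferBounds α C c R) (n : ℕ) (m : Measure ℂ)
    (hm : ∀ᵐ b ∂m, 0 ≤ b.im) (hR : m univ ≤ 2 * m {u | ‖u‖ₑ ≤ R}) :
    c * (chainMass α n * m univ)
      ≤ 4 * (1 + R + R) ^ 2 * ∫⁻ b, (transfer α)^[n + 1] 1 b ∂m := by
  have hmeas := measurable_iterate_transfer (α := α) (f := 1) measurable_one (n + 1)
  have h1 : c * chainMass α n * m {u | ‖u‖ₑ ≤ R}
      ≤ 2 * (1 + R + R) ^ 2 * ∫⁻ b, (transfer α)^[n + 1] 1 b ∂m := by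
    rw [← setLIntegral_const, ← lintegral_const_mul _ hmeas]
    refine (setLIntegral_mono_ae (by fun_prop) ?_).trans (setLIntegral_le_lintegral _ _)
    filter_upwards [hm] with b hb hbR
    exact h.le_iterate n hb hbR
  calc c * (chainMass α n * m univ) ≤ c * (chainMass α n * (2 * m {u | ‖u‖ₑ ≤ R})) := by gcongr
    _ = 2 * (c * chainMass α n * m {u | ‖u‖ₑ ≤ R}) := by ring
    _ ≤ 2 * (2 * (1 + R + R) ^ 2 * ∫⁻ b, (transfer α)^[n + 1] 1 b ∂m) := by gcongr
    _ = _ := by ring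

theorem chainMass_zero {β : Measure ℂ} : chainMass β 0 = 1 := by simp [chainMass]

theorem chainMass_add (m n : ℕ) :
    chainMass α (m + n + 1)
      = ∫⁻ b, (transfer α)^[n + 1] 1 b ∂((dualTransfer α)^[m] (Measure.dirac 0)) := by
  rw [← lintegral_iterate_dualTransfer _ measurable_one, ← Function.iterate_add_apply, chainMass,
    Pi.one_def, lintegral_one, add_comm (n + 1) m, add_assoc]

theorem chainMass_add_le (h : TransferBounds α C c R) (m n : ℕ) :
    chainMass α (m + n + 1) ≤ C * (chainMass α m * chainMass α n) := by
  rw [chainMass_add, mul_comm (chainMass α m)]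
  exact h.lintegral_iterate_le n _ (h.chain_im m)

theorem le_chainMass_add (h : TransferBounds α C c R) (m n : ℕ) :
    c * (chainMass α m * chainMass α n)
      ≤ 4 * (1 + R + R) ^ 2 * chainMass α (m + n + 1) := by
  rw [chainMass_add, mul_comm (chainMass α m)]
  exact h.le_lintegral_iterate n _ (h.chain_im m) (h.chain_tight m)

end TransferBounds

end

section

/-! ### Bounds for the single-site distribution -/

theorem enorm_inv_sq_sub_eq (z : ℂ) (hz : 0 < z.im) (v : ℝ) :
    ‖((v : ℂ) - z)⁻¹‖ₑ ^ 2
      = ENNReal.ofReal (Real.pi * z.im⁻¹) * cauchyPDF z.re z.im.toNNReal v := by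
  rw [cauchyPDF_def, ← ENNReal.ofReal_mul (by positivity), ← ofReal_norm,
    ← ENNReal.ofReal_pow (norm_nonneg _), cauchyPDFReal_def, norm_inv, inv_pow,
    Complex.sq_norm, Complex.normSq_apply, Real.coe_toNNReal _ hz.le]
  congr 1
  simp only [Complex.sub_re, Complex.sub_im, Complex.ofReal_re, Complex.ofReal_im]
  have e : (v - z.re) * (v - z.re) + (0 - z.im) * (0 - z.im) = (v - z.re) ^ 2 + z.im ^ 2 := by ring
  have hpi := Real.pi_ne_zero
  rw [e]
  field_simp

/-- The Poisson integral of a constant. -/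
theorem lintegral_enorm_inv_sq (z : ℂ) (hz : 0 < z.im) :
    ∫⁻ v : ℝ, ‖((v : ℂ) - z)⁻¹‖ₑ ^ 2 = ENNReal.ofReal Real.pi * (ENNReal.ofReal z.im)⁻¹ := by
  simp_rw [enorm_inv_sq_sub_eq z hz]
  rw [lintegral_const_mul _ (measurable_cauchyPDF _ _), lintegral_cauchyPDF_eq_one _ (by simpa),
    mul_one, ENNReal.ofReal_mul Real.pi_nonneg, ENNReal.ofReal_inv_of_pos hz]

/-- A lower bound on `|z|⁻²`. The condition `z ≠ 0` matters because `0⁻¹ = 0`. -/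
theorem one_le_enorm_sq_mul_inv {z : ℂ} (hz : z ≠ 0) {D : ℝ≥0∞} (h : ‖z‖ₑ ≤ D) :
    1 ≤ D ^ 2 * ‖z⁻¹‖ₑ ^ 2 := by
  have h1 : ‖z‖ₑ ^ 2 * ‖z⁻¹‖ₑ ^ 2 = 1 := by
    rw [← mul_pow, ← enorm_mul, mul_inv_cancel₀ hz]; simp
  rw [← h1]
  gcongr

/-- The conditions on the single-site distribution `ν` that enter the estimates: it has a density
bounded by `M` which is dominated by the mass of unit balls, and at least half of its mass is in
the ball of radius `L`. -/
structure SiteLaw (ν : Measure ℝ) (M A L : ℝ≥0∞) : Prop where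
  density : ∃ r : ℝ → ℝ≥0∞, Measurable r ∧ ν = volume.withDensity r ∧ (∀ᵐ v, r v ≤ M) ∧
    ∀ᵐ v, r v ≤ A * ν (Metric.ball v 1)
  tight : 1 ≤ 2 * ν {v | ‖v‖ₑ ≤ L}

namespace SiteLaw

variable {ν : Measure ℝ} {M A L : ℝ≥0∞}

theorem lintegral_le (h : SiteLaw ν M A L) {f : ℝ → ℝ≥0∞} (hf : Measurable f) :
    ∫⁻ v, f v ∂ν ≤ M * ∫⁻ v, f v := by
  obtain ⟨r, hr, hν, hM, -⟩ := h.density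
  rw [hν, lintegral_withDensity_eq_lintegral_mul _ hr hf, ← lintegral_const_mul _ hf]
  refine lintegral_mono_ae ?_
  filter_upwards [hM] with v hv
  rw [Pi.mul_apply]
  gcongr

/-- On a unit ball, the density is at most a multiple of the mass of the concentric ball of radius
two. -/
theorem setLIntegral_ball_le (h : SiteLaw ν M A L) {f : ℝ → ℝ≥0∞} (hf : Measurable f) (x : ℝ) :
    ∫⁻ v in Metric.ball x 1, f v ∂ν ≤ A * ν (Metric.ball x 2) * ∫⁻ v, f v := by
  obtain ⟨r, hr, hν, -, hA⟩ := h.density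
  refine le_trans ?_ (mul_le_mul_right (setLIntegral_le_lintegral (Metric.ball x 1) f) _)
  rw [← lintegral_const_mul _ hf]
  nth_rewrite 1 [hν]
  rw [setLIntegral_withDensity_eq_setLIntegral_mul _ hr hf measurableSet_ball]
  refine setLIntegral_mono_ae (by fun_prop) ?_
  filter_upwards [hA] with v hv hvx
  rw [Pi.mul_apply]
  have : Metric.ball v 1 ⊆ Metric.ball x 2 :=
    Metric.ball_subset_ball' (by rw [Metric.mem_ball] at hvx; linarith)
  exact mul_le_mul_left (hv.trans (mul_le_mul_right (measure_mono this) _)) _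

theorem lintegral_enorm_inv_sq_le (h : SiteLaw ν M A L) (z : ℂ) (hz : 0 < z.im) :
    ∫⁻ v, ‖((v : ℂ) - z)⁻¹‖ₑ ^ 2 ∂ν
      ≤ M * ENNReal.ofReal Real.pi * (ENNReal.ofReal z.im)⁻¹ := by
  refine (h.lintegral_le (by fun_prop)).trans ?_
  rw [lintegral_enorm_inv_sq z hz, mul_assoc]

end SiteLaw

/-- The law of `v - ζ - s` for independent `s ∼ σ` and `v ∼ ν`. -/
def coeffLaw (ν : Measure ℝ) (ζ : ℂ) (σ : Measure ℂ) : Measure ℂ :=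
  (σ.prod ν).map fun p => (p.2 : ℂ) - ζ - p.1

instance (ν : Measure ℝ) [IsProbabilityMeasure ν] (ζ : ℂ) (σ : Measure ℂ)
    [IsProbabilityMeasure σ] : IsProbabilityMeasure (coeffLaw ν ζ σ) :=
  Measure.isProbabilityMeasure_map (by fun_prop)

theorem transfer_coeffLaw (ν : Measure ℝ) [SFinite ν] (ζ : ℂ) (σ : Measure ℂ) [SFinite σ]
    {f : ℂ → ℝ≥0∞} (hf : Measurable f) (b : ℂ) :
    transfer (coeffLaw ν ζ σ) f b
      = ∫⁻ s, ∫⁻ v, ‖((v : ℂ) - (ζ + s + b))⁻¹‖ₑ ^ 2 * f ((v : ℂ) - (ζ + s + b))⁻¹ ∂ν ∂σ := by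
  rw [transfer, coeffLaw, lintegral_map (by fun_prop) (by fun_prop), lintegral_prod _ (by fun_prop)]
  simp only [sub_sub]

theorem transfer_coeffLaw_one (ν : Measure ℝ) [SFinite ν] (ζ : ℂ) (σ : Measure ℂ) [SFinite σ]
    (b : ℂ) :
    transfer (coeffLaw ν ζ σ) 1 b
      = ∫⁻ s, ∫⁻ v, ‖((v : ℂ) - (ζ + s + b))⁻¹‖ₑ ^ 2 ∂ν ∂σ := by
  rw [transfer_coeffLaw _ _ _ measurable_one]
  simp

/-- Moment conditions on the law `σ` of the sum of the side-branch Green functions. -/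
structure BranchLaw (σ : Measure ℂ) (B : ℝ≥0∞) : Prop where
  ae_im : ∀ᵐ s ∂σ, 0 < s.im
  norm_moment : ∫⁻ s, ‖s‖ₑ ^ 4 ∂σ ≤ B
  im_moment : ∫⁻ s, (ENNReal.ofReal s.im)⁻¹ ^ 3 ∂σ ≤ B

/-- Markov's inequality: a large ball carries at least half of the mass. -/
theorem one_le_two_mul_measure_enorm_le {B L : ℝ≥0∞} (hL : 1 + 2 * B ≤ L) (hLf : L ≠ ∞)
    (σ : Measure ℂ) [IsProbabilityMeasure σ] (h : ∫⁻ s, ‖s‖ₑ ^ 4 ∂σ ≤ B) :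
    1 ≤ 2 * σ {s | ‖s‖ₑ ≤ L} := by
  have hL1 : 1 ≤ L := le_self_add.trans hL
  have h1 : L * σ {s | ‖s‖ₑ ≤ L}ᶜ ≤ B := by
    calc L * σ {s | ‖s‖ₑ ≤ L}ᶜ ≤ L * σ {s | L ≤ ‖s‖ₑ ^ 4} := by
          gcongr
          intro s hs
          simp only [mem_compl_iff, mem_ofPred_eq, not_le] at hs
          exact hs.le.trans (le_self_pow₀ (hL1.trans hs.le) (by norm_num))
      _ ≤ ∫⁻ s, ‖s‖ₑ ^ 4 ∂σ := mul_meas_ge_le_lintegral₀ (by fun_prop) _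
      _ ≤ B := h
  have h2 : 2 * σ {s | ‖s‖ₑ ≤ L}ᶜ ≤ 1 := by
    have h3 : L * (2 * σ {s | ‖s‖ₑ ≤ L}ᶜ) ≤ L * 1 := by
      calc L * (2 * σ {s | ‖s‖ₑ ≤ L}ᶜ) = 2 * (L * σ {s | ‖s‖ₑ ≤ L}ᶜ) := by ring
        _ ≤ 2 * B := by gcongr
        _ ≤ L * 1 := by rw [mul_one]; exact le_add_self.trans hL
    exact (ENNReal.mul_le_mul_iff_right (zero_lt_one.trans_le hL1).ne' hLf).1 h3
  have h4 := measure_add_measure_compl (μ := σ) (measurableSet_enorm_le L)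
  rw [measure_univ] at h4
  have h5 : (1 : ℝ≥0∞) + 1 ≤ 2 * σ {s | ‖s‖ₑ ≤ L} + 1 := by
    calc (1 : ℝ≥0∞) + 1 = 2 * (σ {s | ‖s‖ₑ ≤ L} + σ {s | ‖s‖ₑ ≤ L}ᶜ) := by
          rw [h4]; norm_num
      _ = 2 * σ {s | ‖s‖ₑ ≤ L} + 2 * σ {s | ‖s‖ₑ ≤ L}ᶜ := by ring
      _ ≤ _ := by gcongr
  exact (ENNReal.add_le_add_iff_right (by norm_num)).1 h5

theorem le_one_add_pow_three (x : ℝ≥0∞) : x ≤ 1 + x ^ 3 := by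
  rcases le_total x 1 with h | h
  · exact h.trans le_self_add
  · exact (le_self_pow₀ h (by norm_num)).trans le_add_self

/-- A quantitative uniform integrability bound: for `w ≥ N²`, the product `w X` is a small multiple
of `X² + w³`. -/
theorem mul_le_inv_mul_sq_add_cube {w X N : ℝ≥0∞} (hN : N ≠ 0) (hN' : N ≠ ∞) (hw : N ^ 2 ≤ w) :
    w * X ≤ N⁻¹ * (X ^ 2 + w ^ 3) := by
  rw [mul_comm N⁻¹, ← div_eq_mul_inv, ENNReal.le_div_iff_mul_le (Or.inl hN) (Or.inl hN')]
  rcases le_total X (N * w) with h | h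
  · calc w * X * N ≤ w * (N * w) * N := by gcongr
      _ = N ^ 2 * w ^ 2 := by ring
      _ ≤ w * w ^ 2 := by gcongr
      _ = w ^ 3 := by ring
      _ ≤ _ := le_add_self
  · calc w * X * N = N * w * X := by ring
      _ ≤ X * X := by gcongr
      _ = X ^ 2 := by ring
      _ ≤ _ := le_self_add

theorem add_pow_four_le (a b : ℝ≥0∞) : (a + b) ^ 4 ≤ 16 * (a ^ 4 + b ^ 4) := by
  have h : a + b ≤ 2 * max a b := by
    rw [two_mul]; exact add_le_add (le_max_left _ _) (le_max_right _ _)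
  calc (a + b) ^ 4 ≤ (2 * max a b) ^ 4 := by gcongr
    _ = 16 * max a b ^ 4 := by rw [mul_pow]; norm_num
    _ ≤ _ := by
      gcongr
      rcases le_total a b with h | h
      · rw [max_eq_right h]; exact le_add_self
      · rw [max_eq_left h]; exact le_self_add

theorem ofReal_im_le_enorm (z : ℂ) : ENNReal.ofReal z.im ≤ ‖z‖ₑ := by
  rw [← ofReal_norm]
  exact ENNReal.ofReal_le_ofReal ((le_abs_self _).trans (Complex.abs_im_le_norm z))

end

section

/-! ### Bounds for the transfer operator of the tree -/

theorem ae_im_coeffLaw {ν : Measure ℝ} [SFinite ν] {σ : Measure ℂ} {B : ℝ≥0∞} {ζ : ℂ}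
    (hσ : BranchLaw σ B) (hζ : 0 < ζ.im) :
    ∀ᵐ a ∂(coeffLaw ν ζ σ), a.im < 0 := by
  rw [coeffLaw, ae_map_iff (by fun_prop) (measurableSet_lt Complex.measurable_im measurable_const)]
  have h : ∀ᵐ p ∂(σ.prod ν), 0 < p.1.im := Measure.quasiMeasurePreserving_fst.ae hσ.ae_im
  filter_upwards [h] with p hp
  simp only [Complex.sub_im, Complex.ofReal_im]
  linarith

section Bounds

variable {ν : Measure ℝ} [IsProbabilityMeasure ν] {σ : Measure ℂ} [IsProbabilityMeasure σ]
  {M A L B L' : ℝ≥0∞} {ζ : ℂ}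

theorem lintegral_inv_im_le (hσ : BranchLaw σ B) :
    ∫⁻ s, (ENNReal.ofReal s.im)⁻¹ ∂σ ≤ 1 + B := by
  calc ∫⁻ s, (ENNReal.ofReal s.im)⁻¹ ∂σ ≤ ∫⁻ s, (1 + (ENNReal.ofReal s.im)⁻¹ ^ 3) ∂σ :=
        lintegral_mono fun s => le_one_add_pow_three _
    _ ≤ 1 + B := by
      rw [lintegral_add_left measurable_const, lintegral_const, measure_univ, mul_one]
      gcongr
      exact hσ.im_moment

theorem transfer_one_le (hν : SiteLaw ν M A L) (hσ : BranchLaw σ B) (hζ : 0 < ζ.im) {b : ℂ}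
    (hb : 0 ≤ b.im) :
    transfer (coeffLaw ν ζ σ) 1 b ≤ M * ENNReal.ofReal Real.pi * (1 + B) := by
  rw [transfer_coeffLaw_one]
  calc _ ≤ ∫⁻ s, M * ENNReal.ofReal Real.pi * (ENNReal.ofReal s.im)⁻¹ ∂σ := by
        refine lintegral_mono_ae ?_
        filter_upwards [hσ.ae_im] with s hs
        have him : s.im ≤ (ζ + s + b).im := by simp only [Complex.add_im]; linarith
        refine (hν.lintegral_enorm_inv_sq_le _ (hs.trans_le him)).trans ?_
        gcongr
    _ ≤ _ := by
        rw [lintegral_const_mul _ (by fun_prop)]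
        gcongr
        exact lintegral_inv_im_le hσ

/-- A lower bound on `T1` from the mass of a set of potentials at a bounded distance. -/
theorem measure_le_transfer_one (hζ : 0 < ζ.im) (hσ : BranchLaw σ B)
    (hL' : 1 ≤ 2 * σ {s | ‖s‖ₑ ≤ L'}) {b : ℂ} (hb : 0 ≤ b.im) {S : Set ℝ}
    {D : ℝ≥0∞} (h : ∀ v ∈ S, ∀ s : ℂ, ‖s‖ₑ ≤ L' → ‖(v : ℂ) - (ζ + s + b)‖ₑ ≤ D) :
    ν S ≤ 2 * D ^ 2 * transfer (coeffLaw ν ζ σ) 1 b := by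
  rw [transfer_coeffLaw_one]
  have hs := measurableSet_enorm_le L'
  calc ν S ≤ (2 * σ {s | ‖s‖ₑ ≤ L'}) * ν S := le_mul_of_one_le_left' hL'
    _ = 2 * ∫⁻ s in {s | ‖s‖ₑ ≤ L'}, ν S ∂σ := by rw [setLIntegral_const]; ring
    _ ≤ 2 * ∫⁻ s, D ^ 2 * ∫⁻ v, ‖((v : ℂ) - (ζ + s + b))⁻¹‖ₑ ^ 2 ∂ν ∂σ := by
        refine mul_le_mul_right (le_trans (setLIntegral_mono_ae ?_ ?_)
          (setLIntegral_le_lintegral {s : ℂ | ‖s‖ₑ ≤ L'} _)) _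
        · have : Measurable fun p : ℂ × ℝ => ‖((p.2 : ℂ) - (ζ + p.1 + b))⁻¹‖ₑ ^ 2 := by fun_prop
          exact (this.lintegral_prod_right'.const_mul _).aemeasurable
        filter_upwards [hσ.ae_im] with s hsi hsL
        rw [← setLIntegral_one, ← lintegral_const_mul _ (by fun_prop)]
        refine (setLIntegral_mono (by fun_prop) fun v hv => ?_).trans
          (setLIntegral_le_lintegral S _)
        refine one_le_enorm_sq_mul_inv (fun h0 => ?_) (h v hv s hsL)
        have := congrArg Complex.im h0
        simp only [Complex.sub_im, Complex.add_im, Complex.ofReal_im, Complex.zero_im] at this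
        linarith
    _ = _ := by
        rw [lintegral_const_mul _ (by
          have : Measurable fun p : ℂ × ℝ => ‖((p.2 : ℂ) - (ζ + p.1 + b))⁻¹‖ₑ ^ 2 := by fun_prop
          exact this.lintegral_prod_right')]
        ring

theorem le_transfer_one (hν : SiteLaw ν M A L) (hσ : BranchLaw σ B) (hζ : 0 < ζ.im)
    {Z : ℝ≥0∞} (hZ : ‖ζ‖ₑ ≤ Z) (hL' : 1 ≤ 2 * σ {s | ‖s‖ₑ ≤ L'}) {b : ℂ} (hb : 0 ≤ b.im) :
    (4 * (1 + L + Z + L') ^ 2)⁻¹ ≤ (1 + ‖b‖ₑ) ^ 2 * transfer (coeffLaw ν ζ σ) 1 b := by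
  have h1 := measure_le_transfer_one (ν := ν) hζ hσ hL' hb (S := {v : ℝ | ‖v‖ₑ ≤ L})
    (D := (1 + L + Z + L') * (1 + ‖b‖ₑ)) fun v hv s hs => by
      have hv' : ‖(v : ℂ)‖ₑ ≤ L := by
        have : ‖(v : ℂ)‖ₑ = ‖v‖ₑ := by rw [← ofReal_norm, ← ofReal_norm, Complex.norm_real]
        rw [this]; exact hv
      calc ‖(v : ℂ) - (ζ + s + b)‖ₑ ≤ ‖(v : ℂ)‖ₑ + ((‖ζ‖ₑ + ‖s‖ₑ) + ‖b‖ₑ) :=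
            (enorm_sub_le).trans (by
              gcongr; exact (enorm_add_le _ _).trans (by gcongr; exact enorm_add_le _ _))
        _ ≤ L + ((Z + L') + ‖b‖ₑ) := by gcongr
        _ ≤ (L + Z + L') * (1 + ‖b‖ₑ) + (1 + ‖b‖ₑ) := by
            rw [mul_add, mul_one]
            calc L + ((Z + L') + ‖b‖ₑ) = (L + Z + L') + ‖b‖ₑ := by ring
              _ ≤ _ := add_le_add le_self_add le_add_self
        _ = _ := by ring
  rw [← one_div]
  refine ENNReal.div_le_of_le_mul ?_
  calc (1 : ℝ≥0∞) ≤ 2 * ν {v | ‖v‖ₑ ≤ L} := hν.tight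
    _ ≤ 2 * (2 * ((1 + L + Z + L') * (1 + ‖b‖ₑ)) ^ 2 * transfer (coeffLaw ν ζ σ) 1 b) := by gcongr
    _ = _ := by ring

/-- The part of `T1` that comes from large values, for a fixed contribution `s` of the side
branches.  It vanishes unless `Im s` is small, and is then compared to `T1` through the mass of a
ball around the real part of the resonance. -/
theorem lintegral_large_le (hν : SiteLaw ν M A L) (hσ : BranchLaw σ B) (hζ : 0 < ζ.im)
    (hL' : 1 ≤ 2 * σ {s | ‖s‖ₑ ≤ L'}) {b : ℂ} (hb : 0 ≤ b.im) {N : ℝ≥0∞} (hN : 1 ≤ N)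
    (hN' : N ≠ ∞) {s : ℂ} (hs : 0 < s.im) :
    ∫⁻ v, ‖((v : ℂ) - (ζ + s + b))⁻¹‖ₑ ^ 2
        * {u : ℂ | ‖u‖ₑ ≤ N ^ 2}ᶜ.indicator 1 ((v : ℂ) - (ζ + s + b))⁻¹ ∂ν
      ≤ 2 * A * ENNReal.ofReal Real.pi * transfer (coeffLaw ν ζ σ) 1 b
        * (N⁻¹ * ((3 + L' + ‖s‖ₑ) ^ 4 + (ENNReal.ofReal s.im)⁻¹ ^ 3)) := by
  set z := ζ + s + b with hz
  have him : s.im ≤ z.im := by simp only [hz, Complex.add_im]; linarith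
  have hzp : 0 < z.im := hs.trans_le him
  have hsub : ∀ v : ℝ, ENNReal.ofReal z.im ≤ ‖(v : ℂ) - z‖ₑ := fun v => by
    have := ofReal_im_le_enorm (-((v : ℂ) - z))
    rw [enorm_neg] at this
    simpa using this
  have hinv : ∀ v : ℝ, ‖((v : ℂ) - z)⁻¹‖ₑ = ‖(v : ℂ) - z‖ₑ⁻¹ := fun v => by
    refine enorm_inv fun h0 => ?_
    have := congrArg Complex.im h0
    simp only [Complex.sub_im, Complex.ofReal_im, Complex.zero_im] at this
    linarith
  have hN2 : (1 : ℝ≥0∞) ≤ N ^ 2 := one_le_pow₀ hN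
  by_cases hcase : (ENNReal.ofReal z.im)⁻¹ ≤ N ^ 2
  · -- all values are at most `N²`
    refine le_trans (le_of_eq ?_) zero_le
    rw [lintegral_eq_zero_iff (by
      have := (measurable_one (α := ℝ≥0∞)).indicator (measurableSet_enorm_le (N ^ 2)).compl
      fun_prop)]
    refine Filter.Eventually.of_forall fun v => ?_
    change _ * _ = (0 : ℝ≥0∞)
    rw [indicator_of_notMem, mul_zero]
    simp only [mem_compl_iff, mem_ofPred_eq, not_not]
    rw [hinv]
    exact (ENNReal.inv_le_inv.2 (hsub v)).trans hcase
  · rw [not_le] at hcase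
    have hz1 : ENNReal.ofReal z.im ≤ 1 := by
      rw [← ENNReal.inv_le_inv, inv_one]; exact hN2.trans hcase.le
    have hw : (ENNReal.ofReal z.im)⁻¹ ≤ (ENNReal.ofReal s.im)⁻¹ :=
      ENNReal.inv_le_inv.2 (ENNReal.ofReal_le_ofReal him)
    have hz1' : z.im ≤ 1 := by
      have := ENNReal.toReal_mono (by norm_num) hz1
      rwa [ENNReal.toReal_ofReal hzp.le, ENNReal.toReal_one] at this
    have h1 : ∫⁻ v, ‖((v : ℂ) - z)⁻¹‖ₑ ^ 2
          * {u : ℂ | ‖u‖ₑ ≤ N ^ 2}ᶜ.indicator 1 ((v : ℂ) - z)⁻¹ ∂ν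
        ≤ ∫⁻ v in Metric.ball z.re 1, ‖((v : ℂ) - z)⁻¹‖ₑ ^ 2 ∂ν := by
      rw [← lintegral_indicator measurableSet_ball]
      refine lintegral_mono fun v => ?_
      by_cases hv : v ∈ Metric.ball z.re 1
      · rw [indicator_of_mem hv]
        refine mul_le_of_le_one_right' ?_
        exact indicator_le_self' (fun _ _ => zero_le) _
      · rw [indicator_of_notMem hv, indicator_of_notMem, mul_zero]
        simp only [mem_compl_iff, mem_ofPred_eq, not_not]
        rw [hinv]
        refine le_trans ?_ hN2
        rw [ENNReal.inv_le_one, ← ofReal_norm, ← ENNReal.ofReal_one]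
        refine ENNReal.ofReal_le_ofReal ?_
        rw [Metric.mem_ball, not_lt, Real.dist_eq] at hv
        refine hv.trans ?_
        have := Complex.abs_re_le_norm ((v : ℂ) - z)
        simpa using this
    have h2 : ν (Metric.ball z.re 2)
        ≤ 2 * (3 + L' + ‖s‖ₑ) ^ 2 * transfer (coeffLaw ν ζ σ) 1 b := by
      refine measure_le_transfer_one hζ hσ hL' hb fun v hv s' hs' => ?_
      have e : (v : ℂ) - (ζ + s' + b) = ((v - z.re : ℝ) : ℂ) + (s - s') - (z.im : ℂ) * Complex.I := by
        have := Complex.re_add_im z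
        rw [Complex.ofReal_sub, ← sub_eq_zero]
        calc _ = (z.re : ℂ) + z.im * Complex.I - (ζ + s + b) := by ring
          _ = 0 := by rw [this, hz, sub_self]
      have e1 : ‖((v - z.re : ℝ) : ℂ)‖ₑ ≤ 2 := by
        rw [← ofReal_norm, Complex.norm_real, ← ENNReal.ofReal_ofNat 2]
        rw [Metric.mem_ball, Real.dist_eq] at hv
        exact ENNReal.ofReal_le_ofReal hv.le
      have e2 : ‖(z.im : ℂ) * Complex.I‖ₑ ≤ 1 := by
        rw [← ofReal_norm, norm_mul, Complex.norm_I, mul_one, Complex.norm_real,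
          Real.norm_of_nonneg hzp.le]
        exact hz1
      rw [e]
      calc _ ≤ ‖((v - z.re : ℝ) : ℂ)‖ₑ + (‖s‖ₑ + ‖s'‖ₑ) + ‖(z.im : ℂ) * Complex.I‖ₑ :=
            (enorm_sub_le).trans (by
              gcongr; exact (enorm_add_le _ _).trans (by gcongr; exact enorm_sub_le))
        _ ≤ 2 + (‖s‖ₑ + L') + 1 := by gcongr
        _ = 3 + L' + ‖s‖ₑ := by ring
    calc _ ≤ A * ν (Metric.ball z.re 2) * ∫⁻ v : ℝ, ‖((v : ℂ) - z)⁻¹‖ₑ ^ 2 :=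
          h1.trans (hν.setLIntegral_ball_le (by fun_prop) _)
      _ ≤ A * (2 * (3 + L' + ‖s‖ₑ) ^ 2 * transfer (coeffLaw ν ζ σ) 1 b)
          * (ENNReal.ofReal Real.pi * (ENNReal.ofReal s.im)⁻¹) := by
          rw [lintegral_enorm_inv_sq z hzp]
          gcongr
      _ = 2 * A * ENNReal.ofReal Real.pi * transfer (coeffLaw ν ζ σ) 1 b
          * ((ENNReal.ofReal s.im)⁻¹ * (3 + L' + ‖s‖ₑ) ^ 2) := by ring
      _ ≤ _ := by
          refine mul_le_mul_right ?_ _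
          have := mul_le_inv_mul_sq_add_cube (X := (3 + L' + ‖s‖ₑ) ^ 2)
            (zero_lt_one.trans_le hN).ne' hN' (hcase.le.trans hw)
          rwa [← pow_mul] at this

theorem transfer_large_le (hν : SiteLaw ν M A L) (hσ : BranchLaw σ B) (hζ : 0 < ζ.im)
    (hL' : 1 ≤ 2 * σ {s | ‖s‖ₑ ≤ L'}) {b : ℂ} (hb : 0 ≤ b.im) {N : ℝ≥0∞} (hN : 1 ≤ N)
    (hN' : N ≠ ∞) :
    transfer (coeffLaw ν ζ σ) ({u : ℂ | ‖u‖ₑ ≤ N ^ 2}ᶜ.indicator 1) b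
      ≤ 2 * A * ENNReal.ofReal Real.pi * (16 * ((3 + L') ^ 4 + B) + B) * N⁻¹
        * transfer (coeffLaw ν ζ σ) 1 b := by
  rw [transfer_coeffLaw _ _ _ (measurable_one.indicator (measurableSet_enorm_le _).compl)]
  set T := transfer (coeffLaw ν ζ σ) 1 b
  calc _ ≤ ∫⁻ s, 2 * A * ENNReal.ofReal Real.pi * T
        * (N⁻¹ * (16 * ((3 + L') ^ 4 + ‖s‖ₑ ^ 4) + (ENNReal.ofReal s.im)⁻¹ ^ 3)) ∂σ := by
        refine lintegral_mono_ae ?_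
        filter_upwards [hσ.ae_im] with s hs
        refine (lintegral_large_le hν hσ hζ hL' hb hN hN' hs).trans ?_
        gcongr
        exact add_pow_four_le _ _
    _ ≤ 2 * A * ENNReal.ofReal Real.pi * T * (N⁻¹ * (16 * ((3 + L') ^ 4 + B) + B)) := by
        rw [lintegral_const_mul _ (by fun_prop), lintegral_const_mul _ (by fun_prop),
          lintegral_add_left (by fun_prop), lintegral_const_mul _ (by fun_prop),
          lintegral_add_left (by fun_prop), lintegral_const, measure_univ, mul_one]
        have := hσ.norm_moment
        have := hσ.im_moment
        gcongr
    _ = _ := by ring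

end Bounds

/-- The transfer operators of the coefficient laws satisfy bounds that are uniform in the spectral
parameter and depend on the side branches only through their moments. -/
theorem exists_transferBounds {ν : Measure ℝ} [IsProbabilityMeasure ν] {M A L B Z : ℝ≥0∞}
    (hν : SiteLaw ν M A L) (hM : M ≠ ∞) (hA : A ≠ ∞) (hL : L ≠ ∞) (hB : B ≠ ∞) (hZ : Z ≠ ∞) :
    ∃ C c R : ℝ≥0∞, C ≠ ∞ ∧ c ≠ 0 ∧ R ≠ ∞ ∧ 1 + 2 * B ≤ R ∧
      ∀ (ζ : ℂ) (σ : Measure ℂ), 0 < ζ.im → ‖ζ‖ₑ ≤ Z →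
      IsProbabilityMeasure σ → BranchLaw σ B → TransferBounds (coeffLaw ν ζ σ) C c R := by
  -- at least half of the mass of `σ` is in the ball of radius `L'`
  set L' : ℝ≥0∞ := 1 + 2 * B with hL'
  have hL'f : L' ≠ ∞ := by rw [hL']; finiteness
  set Y : ℝ≥0∞ := 2 * A * ENNReal.ofReal Real.pi * (16 * ((3 + L') ^ 4 + B) + B) with hY
  have hYf : Y ≠ ∞ := by rw [hY]; finiteness
  -- `2 Y ≤ N` makes the contribution of values above `N²` at most half of `T1`
  set N : ℝ≥0∞ := 1 + 2 * B + 2 * Y with hN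
  have hNf : N ≠ ∞ := by rw [hN]; finiteness
  have hN1 : 1 ≤ N := by rw [hN, add_assoc]; exact le_self_add
  have hBN : 1 + 2 * B ≤ N := by rw [hN]; exact le_self_add
  refine ⟨M * ENNReal.ofReal Real.pi * (1 + B), (4 * (1 + L + Z + L') ^ 2)⁻¹, N ^ 2,
    by finiteness, ENNReal.inv_ne_zero.2 (by finiteness), by finiteness,
    hBN.trans (le_self_pow₀ hN1 (by norm_num)), fun ζ σ hζ hζZ _ hσ => ?_⟩
  have hLσ := one_le_two_mul_measure_enorm_le le_rfl hL'f σ hσ.norm_moment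
  refine ⟨ae_im_coeffLaw hσ hζ, fun b hb => transfer_one_le hν hσ hζ hb,
    fun b hb => le_transfer_one hν hσ hζ hζZ hLσ hb, fun b hb => ?_⟩
  have hlarge := transfer_large_le hν hσ hζ hLσ hb hN1 hNf
  have hfin : transfer (coeffLaw ν ζ σ) 1 b ≠ ∞ :=
    ((transfer_one_le hν hσ hζ hb).trans_lt (by finiteness)).ne
  have hsplit : transfer (coeffLaw ν ζ σ) 1 b
      = transfer (coeffLaw ν ζ σ) ({u : ℂ | ‖u‖ₑ ≤ N ^ 2}.indicator 1) b
        + transfer (coeffLaw ν ζ σ) ({u : ℂ | ‖u‖ₑ ≤ N ^ 2}ᶜ.indicator 1) b := by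
    unfold transfer
    rw [← lintegral_add_left (by
      have := (measurable_one (α := ℝ≥0∞)).indicator (measurableSet_enorm_le (N ^ 2))
      fun_prop)]
    refine lintegral_congr fun a => ?_
    rw [← mul_add, ← Pi.add_apply, indicator_self_add_compl]
  have hhalf : 2 * (Y * N⁻¹) ≤ 1 := by
    rw [← mul_assoc, ← div_eq_mul_inv]
    refine ENNReal.div_le_of_le_mul ?_
    rw [one_mul, hN]
    exact le_add_self
  set T := transfer (coeffLaw ν ζ σ) 1 b with hT
  set T₁ := transfer (coeffLaw ν ζ σ) ({u : ℂ | ‖u‖ₑ ≤ N ^ 2}.indicator 1) b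
  set T₂ := transfer (coeffLaw ν ζ σ) ({u : ℂ | ‖u‖ₑ ≤ N ^ 2}ᶜ.indicator 1) b
  have h2 : 2 * T₂ ≤ T := by
    calc 2 * T₂ ≤ 2 * (Y * N⁻¹ * T) := by gcongr
      _ = 2 * (Y * N⁻¹) * T := by ring
      _ ≤ 1 * T := by gcongr
      _ = T := one_mul _
  have h3 : T + T ≤ 2 * T₁ + T := by
    calc T + T = 2 * T₁ + 2 * T₂ := by rw [← two_mul, hsplit, mul_add]
      _ ≤ _ := by gcongr
  exact (ENNReal.add_le_add_iff_right hfin).1 h3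

end

section

/-! ### The random field and its restriction to subtrees -/

/-- The law of an independent, identically distributed potential on the tree. -/
def fieldLaw (K : ℕ) (ν : Measure ℝ) [IsProbabilityMeasure ν] : Measure (Vertex K → ℝ) :=
  Measure.infinitePi fun _ => ν

instance (K : ℕ) (ν : Measure ℝ) [IsProbabilityMeasure ν] :
    IsProbabilityMeasure (fieldLaw K ν) := by
  unfold fieldLaw; infer_instance

/-- The potential at the root, together with the potentials on the subtrees of its children. -/
def splitField {K : ℕ} (V : Vertex K → ℝ) : ℝ × (Fin K → Vertex K → ℝ) :=
  (V (root K), fun i y => V (y ++ [i]))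

theorem measurable_splitField {K : ℕ} : Measurable (splitField (K := K)) := by
  unfold splitField
  fun_prop

/-- The values at the root and on the subtrees of its children are independent, and the field on
each subtree has the law of the whole field. -/
theorem map_splitField (K : ℕ) (ν : Measure ℝ) [IsProbabilityMeasure ν] :
    (fieldLaw K ν).map splitField = ν.prod (Measure.pi fun _ : Fin K => fieldLaw K ν) := by
  set f : Fin K × Vertex K → Vertex K := fun p => p.2 ++ [p.1] with hf
  have hfinj : Function.Injective f := by
    rintro ⟨i, x⟩ ⟨j, y⟩ h
    obtain ⟨h1, h2⟩ := List.append_inj' h rfl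
    simp only [List.cons.injEq, and_true] at h2
    exact Prod.ext h2 h1
  have hW : (fieldLaw K ν).map (fun V (i : Fin K) (y : Vertex K) => V (y ++ [i]))
      = Measure.pi fun _ : Fin K => fieldLaw K ν := by
    have h1 := Measure.map_infinitePi_infinitePi_of_inj (P := fun _ : Vertex K => ν) hfinj
    have h2 := Measure.infinitePi_map_curry (fun (_ : Fin K) (_ : Vertex K) => ν)
    rw [Measure.infinitePi_eq_pi (μ := fun _ : Fin K => Measure.infinitePi fun _ : Vertex K => ν)] at h2
    unfold fieldLaw
    rw [← h2, ← h1, Measure.map_map (by fun_prop) (by fun_prop)]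
    rfl
  have hind : iIndepFun (fun (x : Vertex K) (V : Vertex K → ℝ) => V x) (fieldLaw K ν) :=
    iIndepFun_infinitePi (X := fun _ v => v) (by fun_prop)
  have hdisj : Disjoint ({root K} : Set (Vertex K)) (Set.range f) := by
    rw [Set.disjoint_singleton_left]
    rintro ⟨⟨i, x⟩, h⟩
    simp [hf] at h
  have hsup := indep_iSup_of_disjoint (fun x => (measurable_pi_apply x).comap_le) hind hdisj
  have hpair : IndepFun (fun V : Vertex K → ℝ => V (root K))
      (fun V (i : Fin K) (y : Vertex K) => V (y ++ [i])) (fieldLaw K ν) := by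
    refine indep_of_indep_of_le_left (indep_of_indep_of_le_right hsup ?_) ?_
    · simp only [MeasurableSpace.pi, MeasurableSpace.comap_iSup, MeasurableSpace.comap_comp]
      refine iSup_le fun i => iSup_le fun y => ?_
      exact le_iSup₂_of_le (f (i, y)) ⟨(i, y), rfl⟩ le_rfl
    · exact le_iSup₂_of_le (root K) rfl le_rfl
  have := hpair.map_prod_eq_prod_map_map (measurable_pi_apply _).aemeasurable
    (Measurable.aemeasurable (by fun_prop))
  rw [hW] at this
  unfold splitField
  rw [this]
  congr 1
  exact Measure.infinitePi_map_eval (fun _ : Vertex K => ν) (root K)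

/-- The Green function `G(0, 0; ζ)` at the root. -/
def rootGreen {K : ℕ} (ζ : ℂ) (V : Vertex K → ℝ) : ℂ := greenCol V ζ (root K)

theorem measurable_greenCol {K : ℕ} {ζ : ℂ} (hζ : 0 < ζ.im) (x : Vertex K) :
    Measurable fun V : Vertex K → ℝ => greenCol V ζ x :=
  ((continuous_apply x).comp (continuous_greenCol (v := fun V : Vertex K → ℝ => V)
    (z := fun _ => ζ) continuous_id continuous_const hζ fun _ => le_rfl)).measurable

theorem measurable_rootGreen {K : ℕ} {ζ : ℂ} (hζ : 0 < ζ.im) :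
    Measurable (rootGreen (K := K) ζ) := measurable_greenCol hζ _

/-- The law of the Green function at the root. -/
def rootLaw (K : ℕ) (ν : Measure ℝ) [IsProbabilityMeasure ν] (ζ : ℂ) : Measure ℂ :=
  (fieldLaw K ν).map (rootGreen ζ)

/-- The law of the sum of `k` independent copies of the Green function at the root of the tree
with branching number `k + 1`. -/
def branchLaw (k : ℕ) (ν : Measure ℝ) [IsProbabilityMeasure ν] (ζ : ℂ) : Measure ℂ :=
  (Measure.pi fun _ : Fin k => fieldLaw (k + 1) ν).map fun W => ∑ j, rootGreen ζ (W j)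

variable {k : ℕ} {ν : Measure ℝ} [IsProbabilityMeasure ν] {ζ : ℂ}

theorem measurable_sum_rootGreen (hζ : 0 < ζ.im) :
    Measurable fun W : Fin k → Vertex (k + 1) → ℝ => ∑ j, rootGreen ζ (W j) :=
  Finset.measurable_fun_sum _ fun j _ => (measurable_rootGreen hζ).comp (measurable_pi_apply j)

theorem isProbabilityMeasure_rootLaw (K : ℕ) (hζ : 0 < ζ.im) :
    IsProbabilityMeasure (rootLaw K ν ζ) :=
  Measure.isProbabilityMeasure_map (measurable_rootGreen hζ).aemeasurable

theorem isProbabilityMeasure_branchLaw (hζ : 0 < ζ.im) :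
    IsProbabilityMeasure (branchLaw k ν ζ) :=
  Measure.isProbabilityMeasure_map (measurable_sum_rootGreen hζ).aemeasurable

/-- The effective coefficient at the root, in which the branch of the child `i` is left out. -/
def effCoeff (ζ : ℂ) (i : Fin (k + 1)) (V : Vertex (k + 1) → ℝ) : ℂ :=
  (V (root _) : ℂ) - ζ - ∑ j : Fin k, rootGreen ζ fun y => V (y ++ [i.succAbove j])

theorem rootGreen_eq (hζ : 0 < ζ.im) (i : Fin (k + 1)) (V : Vertex (k + 1) → ℝ) :
    rootGreen ζ V = (effCoeff ζ i V - rootGreen ζ fun y => V (y ++ [i]))⁻¹ := by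
  rw [rootGreen, greenCol_root V ζ hζ, Fin.sum_univ_succAbove _ i, effCoeff]
  congr 1
  simp only [rootGreen]
  ring

/-- The effective coefficient is independent of the field on the branch that is left out. -/
theorem lintegral_effCoeff (hζ : 0 < ζ.im) (i : Fin (k + 1))
    {F : ℂ × (Vertex (k + 1) → ℝ) → ℝ≥0∞} (hF : Measurable F) :
    ∫⁻ V, F (effCoeff ζ i V, fun y => V (y ++ [i])) ∂(fieldLaw (k + 1) ν)
      = ∫⁻ W, ∫⁻ a, F (a, W) ∂(coeffLaw ν ζ (branchLaw k ν ζ)) ∂(fieldLaw (k + 1) ν) := by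
  have := isProbabilityMeasure_branchLaw (k := k) (ν := ν) hζ
  have hg := measurable_rootGreen (K := k + 1) hζ
  have hS := measurable_sum_rootGreen (k := k) hζ
  set G : ℝ × (Fin (k + 1) → Vertex (k + 1) → ℝ) → ℝ≥0∞ := fun p =>
    F ((p.1 : ℂ) - ζ - ∑ j : Fin k, rootGreen ζ (p.2 (i.succAbove j)), p.2 i) with hG
  have hGm : Measurable G := by
    have h1 : Measurable fun p : ℝ × (Fin (k + 1) → Vertex (k + 1) → ℝ) =>
        ∑ j : Fin k, rootGreen ζ (p.2 (i.succAbove j)) := by fun_prop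
    exact hF.comp (by fun_prop)
  calc ∫⁻ V, F (effCoeff ζ i V, fun y => V (y ++ [i])) ∂(fieldLaw (k + 1) ν)
      = ∫⁻ V, G (splitField V) ∂(fieldLaw (k + 1) ν) := rfl
    _ = ∫⁻ v, ∫⁻ W, G (v, W) ∂(Measure.pi fun _ : Fin (k + 1) => fieldLaw (k + 1) ν) ∂ν := by
        rw [← lintegral_map hGm measurable_splitField, map_splitField,
          lintegral_prod _ hGm.aemeasurable]
    _ = ∫⁻ v, ∫⁻ W, ∫⁻ W', F ((v : ℂ) - ζ - ∑ j : Fin k, rootGreen ζ (W' j), W)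
          ∂(Measure.pi fun _ : Fin k => fieldLaw (k + 1) ν) ∂(fieldLaw (k + 1) ν) ∂ν := by
        refine lintegral_congr fun v => ?_
        have hmp := measurePreserving_piFinSuccAbove (fun _ : Fin (k + 1) => fieldLaw (k + 1) ν) i
        have hm : Measurable fun q : (Vertex (k + 1) → ℝ) × (Fin k → Vertex (k + 1) → ℝ) =>
            F ((v : ℂ) - ζ - ∑ j : Fin k, rootGreen ζ (q.2 j), q.1) :=
          hF.comp (by fun_prop)
        rw [← lintegral_prod (fun q : (Vertex (k + 1) → ℝ) × (Fin k → Vertex (k + 1) → ℝ) =>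
          F ((v : ℂ) - ζ - ∑ j : Fin k, rootGreen ζ (q.2 j), q.1)) hm.aemeasurable,
          ← hmp.lintegral_comp hm]
        rfl
    _ = ∫⁻ W, ∫⁻ v, ∫⁻ W', F ((v : ℂ) - ζ - ∑ j : Fin k, rootGreen ζ (W' j), W)
          ∂(Measure.pi fun _ : Fin k => fieldLaw (k + 1) ν) ∂ν ∂(fieldLaw (k + 1) ν) := by
        refine lintegral_lintegral_swap (Measurable.aemeasurable ?_)
        refine Measurable.lintegral_prod_right' (f := fun q : (ℝ × (Vertex (k + 1) → ℝ)) ×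
          (Fin k → Vertex (k + 1) → ℝ) =>
            F ((q.1.1 : ℂ) - ζ - ∑ j : Fin k, rootGreen ζ (q.2 j), q.1.2)) ?_
        exact hF.comp (by fun_prop)
    _ = _ := by
        refine lintegral_congr fun W => ?_
        rw [coeffLaw, lintegral_map (by fun_prop) (by fun_prop), branchLaw,
          lintegral_prod_symm _ (by fun_prop)]
        refine lintegral_congr fun v => ?_
        rw [lintegral_map (by fun_prop) hS]

/-- The second moment of the Green function along a path, weighted with a function of the
diagonal element at the root, is given by the iterates of the transfer operator. -/
theorem lintegral_rootGreen_mul_greenCol (hζ : 0 < ζ.im) {h : ℂ → ℝ≥0∞} (hh : Measurable h)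
    (x : Vertex (k + 1)) :
    ∫⁻ V, h (rootGreen ζ V) * ‖greenCol V ζ x‖ₑ ^ 2 ∂(fieldLaw (k + 1) ν)
      = ∫⁻ b, (transfer (coeffLaw ν ζ (branchLaw k ν ζ)))^[x.length + 1] h b
          ∂(rootLaw (k + 1) ν ζ) := by
  have := isProbabilityMeasure_branchLaw (k := k) (ν := ν) hζ
  have hg := measurable_rootGreen (K := k + 1) hζ
  induction x using List.reverseRecOn generalizing h with
  | nil =>
    rw [rootLaw, lintegral_map (measurable_iterate_transfer hh _) hg]
    calc _ = ∫⁻ V, h (effCoeff ζ 0 V - rootGreen ζ fun y => V (y ++ [0]))⁻¹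
          * ‖(effCoeff ζ 0 V - rootGreen ζ fun y => V (y ++ [0]))⁻¹‖ₑ ^ 2
            ∂(fieldLaw (k + 1) ν) := by
          refine lintegral_congr fun V => ?_
          rw [← rootGreen_eq hζ 0 V]
          rfl
      _ = ∫⁻ W, ∫⁻ a, h (a - rootGreen ζ W)⁻¹ * ‖(a - rootGreen ζ W)⁻¹‖ₑ ^ 2
          ∂(coeffLaw ν ζ (branchLaw k ν ζ)) ∂(fieldLaw (k + 1) ν) :=
        lintegral_effCoeff hζ 0 (F := fun p => h (p.1 - rootGreen ζ p.2)⁻¹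
          * ‖(p.1 - rootGreen ζ p.2)⁻¹‖ₑ ^ 2) (by fun_prop)
      _ = _ := by
        refine lintegral_congr fun W => lintegral_congr fun a => ?_
        rw [mul_comm]
  | append_singleton l i ih =>
    have hc := measurable_greenCol hζ l
    rw [List.length_append, List.length_singleton, Function.iterate_succ_apply,
      ← ih (measurable_transfer hh)]
    calc _ = ∫⁻ V, ‖(effCoeff ζ i V - rootGreen ζ fun y => V (y ++ [i]))⁻¹‖ₑ ^ 2
          * h (effCoeff ζ i V - rootGreen ζ fun y => V (y ++ [i]))⁻¹
          * ‖greenCol (fun y => V (y ++ [i])) ζ l‖ₑ ^ 2 ∂(fieldLaw (k + 1) ν) := by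
          refine lintegral_congr fun V => ?_
          rw [← rootGreen_eq hζ i V, greenCol_append_singleton V ζ hζ i l, enorm_mul, mul_pow]
          rw [← mul_assoc, mul_comm (h _)]
          rfl
      _ = ∫⁻ W, ∫⁻ a, ‖(a - rootGreen ζ W)⁻¹‖ₑ ^ 2 * h (a - rootGreen ζ W)⁻¹
          * ‖greenCol W ζ l‖ₑ ^ 2 ∂(coeffLaw ν ζ (branchLaw k ν ζ)) ∂(fieldLaw (k + 1) ν) :=
        lintegral_effCoeff hζ i (F := fun p => ‖(p.1 - rootGreen ζ p.2)⁻¹‖ₑ ^ 2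
          * h (p.1 - rootGreen ζ p.2)⁻¹ * ‖greenCol p.2 ζ l‖ₑ ^ 2) (by fun_prop)
      _ = _ := by
        refine lintegral_congr fun W => ?_
        rw [lintegral_mul_const _ (by fun_prop)]
        rfl

/-- The second moment of the Green function in terms of the transfer operator. -/
theorem lintegral_greenCol_sq (hζ : 0 < ζ.im) (x : Vertex (k + 1)) :
    ∫⁻ V, ‖greenCol V ζ x‖ₑ ^ 2 ∂(fieldLaw (k + 1) ν)
      = ∫⁻ b, (transfer (coeffLaw ν ζ (branchLaw k ν ζ)))^[x.length + 1] 1 b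
          ∂(rootLaw (k + 1) ν ζ) := by
  rw [← lintegral_rootGreen_mul_greenCol hζ measurable_one]
  simp

theorem ae_im_rootLaw (K : ℕ) (hζ : 0 < ζ.im) : ∀ᵐ b ∂(rootLaw K ν ζ), 0 < b.im := by
  rw [rootLaw, ae_map_iff (measurable_rootGreen hζ).aemeasurable
    (measurableSet_lt measurable_const Complex.measurable_im)]
  exact Filter.Eventually.of_forall fun V => im_greenCol_root_pos V ζ hζ

/-! ### Moments of the Green function at the root -/

/-- The fourth moment of the Green function at the root is controlled by the moment of order `-3`
of its imaginary part. -/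
theorem lintegral_rootGreen_pow_four_le {M A L : ℝ≥0∞} (hν : SiteLaw ν M A L) (hζ : 0 < ζ.im) :
    ∫⁻ V, ‖rootGreen ζ V‖ₑ ^ 4 ∂(fieldLaw (k + 1) ν)
      ≤ M * ENNReal.ofReal Real.pi
        * ∫⁻ V, (ENNReal.ofReal (rootGreen ζ V).im)⁻¹ ^ 3 ∂(fieldLaw (k + 1) ν) := by
  have := isProbabilityMeasure_branchLaw (k := k) (ν := ν) hζ
  have hg := measurable_rootGreen (K := k + 1) hζ
  have hσ : ∀ᵐ s ∂(branchLaw k ν ζ), 0 ≤ s.im := by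
    rw [branchLaw, ae_map_iff (measurable_sum_rootGreen hζ).aemeasurable
      (measurableSet_le measurable_const Complex.measurable_im)]
    refine Filter.Eventually.of_forall fun W => ?_
    rw [Complex.im_sum]
    exact Finset.sum_nonneg fun j _ => (im_greenCol_root_pos (W j) ζ hζ).le
  rw [← lintegral_const_mul _ (by fun_prop)]
  calc _ = ∫⁻ V, ‖(effCoeff ζ 0 V - rootGreen ζ fun y => V (y ++ [0]))⁻¹‖ₑ ^ 4
        ∂(fieldLaw (k + 1) ν) := by
        refine lintegral_congr fun V => ?_
        rw [← rootGreen_eq hζ 0 V]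
    _ = ∫⁻ W, ∫⁻ a, ‖(a - rootGreen ζ W)⁻¹‖ₑ ^ 4 ∂(coeffLaw ν ζ (branchLaw k ν ζ))
        ∂(fieldLaw (k + 1) ν) :=
      lintegral_effCoeff hζ 0 (F := fun p => ‖(p.1 - rootGreen ζ p.2)⁻¹‖ₑ ^ 4) (by fun_prop)
    _ ≤ _ := by
      refine lintegral_mono fun W => ?_
      have hw : 0 < (rootGreen ζ W).im := im_greenCol_root_pos W ζ hζ
      rw [coeffLaw, lintegral_map (by fun_prop) (by fun_prop), lintegral_prod _ (by fun_prop)]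
      set U : ℝ≥0∞ := M * ENNReal.ofReal Real.pi * (ENNReal.ofReal (rootGreen ζ W).im)⁻¹ ^ 3 with hU
      have hle : ∀ᵐ s ∂(branchLaw k ν ζ),
          ∫⁻ v, ‖((v : ℂ) - ζ - s - rootGreen ζ W)⁻¹‖ₑ ^ 4 ∂ν ≤ U := by
        filter_upwards [hσ] with s hs
        set z := ζ + s + rootGreen ζ W with hz
        have him : (rootGreen ζ W).im ≤ z.im := by simp only [hz, Complex.add_im]; linarith
        have hzp : 0 < z.im := hw.trans_le him
        have hv : ∀ v : ℝ, ‖((v : ℂ) - ζ - s - rootGreen ζ W)⁻¹‖ₑ ^ 4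
            ≤ (ENNReal.ofReal z.im)⁻¹ ^ 2 * ‖((v : ℂ) - z)⁻¹‖ₑ ^ 2 := fun v => by
          have e : (v : ℂ) - ζ - s - rootGreen ζ W = (v : ℂ) - z := by rw [hz]; ring
          have h0 : (v : ℂ) - z ≠ 0 := fun h0 => by
            have := congrArg Complex.im h0
            simp only [Complex.sub_im, Complex.ofReal_im, Complex.zero_im] at this
            linarith
          have h1 : ‖((v : ℂ) - z)⁻¹‖ₑ ≤ (ENNReal.ofReal z.im)⁻¹ := by
            rw [enorm_inv h0, ENNReal.inv_le_inv]
            have := ofReal_im_le_enorm (-((v : ℂ) - z))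
            rw [enorm_neg] at this
            simpa using this
          rw [e, show (4 : ℕ) = 2 + 2 from rfl, pow_add]
          gcongr
        calc _ ≤ ∫⁻ v, (ENNReal.ofReal z.im)⁻¹ ^ 2 * ‖((v : ℂ) - z)⁻¹‖ₑ ^ 2 ∂ν :=
              lintegral_mono hv
          _ ≤ (ENNReal.ofReal z.im)⁻¹ ^ 2
              * (M * ENNReal.ofReal Real.pi * (ENNReal.ofReal z.im)⁻¹) := by
              rw [lintegral_const_mul _ (by fun_prop)]
              gcongr
              exact hν.lintegral_enorm_inv_sq_le z hzp
          _ = M * ENNReal.ofReal Real.pi * (ENNReal.ofReal z.im)⁻¹ ^ 3 := by ring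
          _ ≤ U := by rw [hU]; gcongr
      refine (lintegral_mono_ae hle).trans ?_
      rw [lintegral_const, measure_univ, mul_one]

theorem sum_pow_four_le {ι : Type*} (s : Finset ι) (f : ι → ℝ≥0∞) :
    (∑ i ∈ s, f i) ^ 4 ≤ 16 ^ s.card * ∑ i ∈ s, f i ^ 4 := by
  classical
  induction s using Finset.induction_on with
  | empty => simp
  | insert a s ha ih =>
    rw [Finset.sum_insert ha, Finset.sum_insert ha, Finset.card_insert_of_notMem ha,
      pow_succ' (16 : ℝ≥0∞)]
    calc _ ≤ 16 * (f a ^ 4 + (∑ i ∈ s, f i) ^ 4) := add_pow_four_le _ _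
      _ ≤ 16 * (16 ^ s.card * f a ^ 4 + 16 ^ s.card * ∑ i ∈ s, f i ^ 4) := by
          gcongr
          exact le_mul_of_one_le_left' (one_le_pow₀ (by norm_num))
      _ = _ := by ring

/-- The moment conditions on the sum of the side branches follow from the ones at the root. -/
theorem branchLaw_bounds (hk : 1 ≤ k) (hζ : 0 < ζ.im) {B₁ B₂ : ℝ≥0∞}
    (h1 : ∫⁻ V, ‖rootGreen ζ V‖ₑ ^ 4 ∂(fieldLaw (k + 1) ν) ≤ B₁)
    (h2 : ∫⁻ V, (ENNReal.ofReal (rootGreen ζ V).im)⁻¹ ^ 3 ∂(fieldLaw (k + 1) ν) ≤ B₂) :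
    BranchLaw (branchLaw k ν ζ) (16 ^ k * (k * B₁) + B₂) := by
  have hg := measurable_rootGreen (K := k + 1) hζ
  have hS := measurable_sum_rootGreen (k := k) hζ
  have hpos : ∀ V : Vertex (k + 1) → ℝ, 0 < (rootGreen ζ V).im :=
    fun V => im_greenCol_root_pos V ζ hζ
  have hev : ∀ (j : Fin k) (f : (Vertex (k + 1) → ℝ) → ℝ≥0∞), Measurable f →
      ∫⁻ W, f (W j) ∂(Measure.pi fun _ : Fin k => fieldLaw (k + 1) ν)
        = ∫⁻ V, f V ∂(fieldLaw (k + 1) ν) := fun j f hf =>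
    (measurePreserving_eval (fun _ : Fin k => fieldLaw (k + 1) ν) j).lintegral_comp hf
  refine ⟨?_, ?_, ?_⟩
  · rw [branchLaw, ae_map_iff hS.aemeasurable
      (measurableSet_lt measurable_const Complex.measurable_im)]
    refine Filter.Eventually.of_forall fun W => ?_
    rw [Complex.im_sum]
    exact Finset.sum_pos (fun j _ => hpos _) ⟨⟨0, hk⟩, Finset.mem_univ _⟩
  · rw [branchLaw, lintegral_map (by fun_prop) hS]
    refine le_trans ?_ le_self_add
    calc _ ≤ ∫⁻ W, 16 ^ k * ∑ j, ‖rootGreen ζ (W j)‖ₑ ^ 4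
          ∂(Measure.pi fun _ : Fin k => fieldLaw (k + 1) ν) := by
          refine lintegral_mono fun W => ?_
          have h3 := sum_pow_four_le Finset.univ fun j => ‖rootGreen ζ (W j)‖ₑ
          rw [Finset.card_univ, Fintype.card_fin] at h3
          refine le_trans ?_ h3
          gcongr
          exact enorm_sum_le _ _
      _ = 16 ^ k * ∑ j : Fin k, ∫⁻ V, ‖rootGreen ζ V‖ₑ ^ 4 ∂(fieldLaw (k + 1) ν) := by
          rw [lintegral_const_mul _ (by fun_prop), lintegral_finsetSum _ (fun j _ => by fun_prop)]
          congr 1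
          exact Finset.sum_congr rfl fun j _ => hev j (fun V => ‖rootGreen ζ V‖ₑ ^ 4) (by fun_prop)
      _ ≤ _ := by
          rw [Finset.sum_const, Finset.card_univ, Fintype.card_fin, nsmul_eq_mul]
          gcongr
  · rw [branchLaw, lintegral_map (by fun_prop) hS]
    refine le_trans ?_ le_add_self
    refine le_trans ?_ h2
    rw [← hev ⟨0, hk⟩ _ (by fun_prop)]
    refine lintegral_mono fun W => ?_
    gcongr
    rw [Complex.im_sum]
    exact Finset.single_le_sum (f := fun j => (rootGreen ζ (W j)).im) (fun j _ => (hpos _).le)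
      (Finset.mem_univ _)

end

section

/-! ### Exponential growth of almost multiplicative sequences -/

/-- Fekete's lemma for a sequence that is multiplicative up to constants. -/
theorem exists_exp_bounds {q : ℕ → ℝ} {a C : ℝ} (ha : 0 < a) (hC : 0 < C) (h0 : q 0 = 1)
    (hpos : ∀ n, 0 < q n) (hlow : ∀ m n, a * (q m * q n) ≤ q (m + n + 1))
    (hup : ∀ m n, q (m + n + 1) ≤ C * (q m * q n)) :
    ∃ φ : ℝ, ∀ n : ℕ, a / C * Real.exp (φ * n) ≤ q n ∧ q n ≤ C / a * Real.exp (φ * n) := by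
  -- the subadditive sequence `log (C p n)` and the superadditive `log (a p n)`, `p n = q (n - 1)`
  set u : ℕ → ℝ := fun n => if n = 0 then 0 else Real.log (C * q (n - 1)) with hu
  set w : ℕ → ℝ := fun n => if n = 0 then 0 else - Real.log (a * q (n - 1)) with hw
  have hu' : ∀ n, u (n + 1) = Real.log (C * q n) := fun n => by simp [hu]
  have hw' : ∀ n, w (n + 1) = - Real.log (a * q n) := fun n => by simp [hw]
  have husub : Subadditive u := by
    intro m n
    rcases m with _ | m
    · simp [hu]
    rcases n with _ | n
    · simp [hu]
    have e : m + 1 + (n + 1) = (m + n + 1) + 1 := by ring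
    rw [e, hu', hu', hu', ← Real.log_mul (mul_pos hC (hpos _)).ne' (mul_pos hC (hpos _)).ne']
    refine Real.log_le_log (mul_pos hC (hpos _)) ?_
    calc C * q (m + n + 1) ≤ C * (C * (q m * q n)) := by gcongr; exact hup m n
      _ = _ := by ring
  have hwsub : Subadditive w := by
    intro m n
    rcases m with _ | m
    · simp [hw]
    rcases n with _ | n
    · simp [hw]
    have e : m + 1 + (n + 1) = (m + n + 1) + 1 := by ring
    rw [e, hw', hw', hw', ← neg_add,
      ← Real.log_mul (mul_pos ha (hpos _)).ne' (mul_pos ha (hpos _)).ne']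
    refine neg_le_neg (Real.log_le_log (mul_pos (mul_pos ha (hpos _)) (mul_pos ha (hpos _))) ?_)
    calc _ = a * (a * (q m * q n)) := by ring
      _ ≤ _ := by gcongr; exact hlow m n
  have haC : a ≤ C := by
    have := (hlow 0 0).trans (hup 0 0)
    simpa [h0] using this
  have hsum : ∀ n, u n + w n = if n = 0 then 0 else Real.log C - Real.log a := fun n => by
    rcases n with _ | n
    · simp [hu, hw]
    · rw [hu', hw', Real.log_mul hC.ne' (hpos _).ne', Real.log_mul ha.ne' (hpos _).ne',
        if_neg (Nat.succ_ne_zero n)]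
      ring
  have hlog : Real.log a ≤ Real.log C := Real.log_le_log ha haC
  have hsum0 : ∀ n, 0 ≤ u n + w n := fun n => by
    rw [hsum]; split_ifs <;> linarith
  have hlin : ∀ (f : ℕ → ℝ), f 0 = 0 → Subadditive f → ∀ n : ℕ, f n ≤ n * f 1 := by
    intro f hf0 hf n
    induction n with
    | zero => simp [hf0]
    | succ n ih =>
      have := hf n 1
      push_cast
      linarith
  have hu0 : u 0 = 0 := by simp [hu]
  have hw0 : w 0 = 0 := by simp [hw]
  have hbdd : ∀ (f g : ℕ → ℝ), g 0 = 0 → Subadditive g → (∀ n, 0 ≤ f n + g n) →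
      BddBelow (Set.range fun n : ℕ => f n / n) := by
    intro f g hg0 hg hfg
    refine ⟨min 0 (- g 1), ?_⟩
    rintro _ ⟨n, rfl⟩
    rcases Nat.eq_zero_or_pos n with rfl | hn
    · simp
    · have hn' : (0 : ℝ) < n := by exact_mod_cast hn
      refine (min_le_right _ _).trans ?_
      change - g 1 ≤ f n / n
      rw [le_div_iff₀ hn']
      have := hlin g hg0 hg n
      have := hfg n
      linarith
  have hub := hbdd u w hw0 hwsub hsum0
  have hwb := hbdd w u hu0 husub fun n => by rw [add_comm]; exact hsum0 n
  have hlimw : hwsub.lim = - husub.lim := by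
    have h1 := (husub.tendsto_lim hub).add (hwsub.tendsto_lim hwb)
    have h2 : Tendsto (fun n : ℕ => u n / n + w n / n) atTop (𝓝 0) := by
      have h3 : Tendsto (fun n : ℕ => (Real.log C - Real.log a) / (n : ℝ)) atTop (𝓝 0) :=
        tendsto_const_div_atTop_nhds_zero_nat _
      refine h3.congr' ?_
      filter_upwards [eventually_ne_atTop 0] with n hn
      rw [← add_div, hsum, if_neg hn]
    have := tendsto_nhds_unique h1 h2
    linarith
  have key : ∀ n : ℕ, Real.exp (husub.lim * (n + 1)) ≤ C * q n ∧
      a * q n ≤ Real.exp (husub.lim * (n + 1)) := fun n => by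
    have hn : (0 : ℝ) < ((n + 1 : ℕ) : ℝ) := by positivity
    constructor
    · have h1 := husub.lim_le_div hub (Nat.succ_ne_zero n)
      rw [hu', le_div_iff₀ hn] at h1
      rw [← Real.exp_log (mul_pos hC (hpos n))]
      push_cast at h1
      exact Real.exp_le_exp.2 h1
    · have h1 := hwsub.lim_le_div hwb (Nat.succ_ne_zero n)
      rw [hw', le_div_iff₀ hn, hlimw] at h1
      rw [← Real.exp_log (mul_pos ha (hpos n))]
      push_cast at h1
      exact Real.exp_le_exp.2 (by linarith)
  -- `q 0 = 1` places `exp φ` between `a` and `C`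
  have k0 := key 0
  simp only [h0, Nat.cast_zero, zero_add, mul_one] at k0
  refine ⟨husub.lim, fun n => ?_⟩
  obtain ⟨h1, h2⟩ := key n
  rw [mul_add, Real.exp_add, mul_one] at h1 h2
  have hE := Real.exp_pos (husub.lim * n)
  constructor
  · rw [div_mul_eq_mul_div, div_le_iff₀ hC]
    calc a * Real.exp (husub.lim * n) ≤ Real.exp husub.lim * Real.exp (husub.lim * n) := by
          gcongr; exact k0.2
      _ ≤ q n * C := by linarith
  · rw [div_mul_eq_mul_div, le_div_iff₀ ha]
    calc q n * a ≤ Real.exp husub.lim * Real.exp (husub.lim * n) := by linarith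
      _ ≤ _ := by gcongr; exact k0.1

/-! ### Uniform exponential bounds for the second moment -/

namespace TransferBounds

variable {α : Measure ℂ} [SFinite α] {C c R : ℝ≥0∞}

theorem c_ne_top {β : Measure ℂ} (h : TransferBounds β C c R) (hC : C ≠ ∞) : c ≠ ∞ := by
  have h1 := h.lower 0 (by simp)
  simp only [enorm_zero, add_zero, one_pow, one_mul] at h1
  exact ((h1.trans (h.upper 0 (by simp))).trans_lt hC.lt_top).ne

theorem chainMass_ne_top (h : TransferBounds α C c R) (hC : C ≠ ∞) (n : ℕ) :
    chainMass α n ≠ ∞ := by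
  induction n with
  | zero => rw [chainMass_zero]; norm_num
  | succ n ih =>
    have := h.chainMass_add_le n 0
    rw [chainMass_zero, mul_one, add_zero] at this
    exact (this.trans_lt (by finiteness)).ne

theorem chainMass_ne_zero (h : TransferBounds α C c R) (hc : c ≠ 0) (n : ℕ) :
    chainMass α n ≠ 0 := by
  induction n with
  | zero => rw [chainMass_zero]; norm_num
  | succ n ih =>
    have := h.le_chainMass_add n 0
    rw [chainMass_zero, mul_one, add_zero] at this
    intro h0
    rw [h0, mul_zero, nonpos_iff_eq_zero] at this
    exact mul_ne_zero hc ih this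

/-- Two-sided exponential bounds for the integrals of the iterates against a measure of mass one
that gives at least half of its mass to a bounded set. -/
theorem exists_exp_bounds (h : TransferBounds α C c R) (hC : C ≠ ∞) (hc : c ≠ 0) (hR : R ≠ ∞)
    (m : Measure ℂ) [IsProbabilityMeasure m] (hm : ∀ᵐ b ∂m, 0 ≤ b.im)
    (hmR : 1 ≤ 2 * m {u | ‖u‖ₑ ≤ R}) :
    let a := c.toReal / (4 * (1 + R + R) ^ 2).toReal
    ∃ φ : ℝ, ∀ n : ℕ,
      ∫⁻ b, (transfer α)^[n + 1] 1 b ∂m ≠ ∞ ∧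
      a * (a / C.toReal) * Real.exp (φ * n) ≤ (∫⁻ b, (transfer α)^[n + 1] 1 b ∂m).toReal ∧
      (∫⁻ b, (transfer α)^[n + 1] 1 b ∂m).toReal
        ≤ C.toReal * (C.toReal / a) * Real.exp (φ * n) := by
  intro a
  set D : ℝ≥0∞ := 4 * (1 + R + R) ^ 2 with hD
  have hDf : D ≠ ∞ := by rw [hD]; finiteness
  have hD0 : D ≠ 0 := by
    rw [hD]
    exact mul_ne_zero (by norm_num) (pow_ne_zero _ (by simp))
  have hcf := h.c_ne_top hC
  have hC0 : C ≠ 0 := fun h0 => by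
    have h1 := h.lower 0 (by simp)
    have h2 := h.upper 0 (by simp)
    rw [h0, nonpos_iff_eq_zero] at h2
    rw [h2, mul_zero, nonpos_iff_eq_zero] at h1
    exact hc h1
  have hDr : 0 < D.toReal := ENNReal.toReal_pos hD0 hDf
  have ha : 0 < a := div_pos (ENNReal.toReal_pos hc hcf) hDr
  have hCr : 0 < C.toReal := ENNReal.toReal_pos hC0 hC
  have hlow : ∀ x y : ℝ≥0∞, y ≠ ∞ → c * x ≤ D * y → a * x.toReal ≤ y.toReal := by
    intro x y hy hxy
    have := ENNReal.toReal_mono (by finiteness) hxy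
    rw [ENNReal.toReal_mul, ENNReal.toReal_mul] at this
    change c.toReal / D.toReal * x.toReal ≤ _
    rw [div_mul_eq_mul_div, div_le_iff₀ hDr]
    linarith
  have hup : ∀ x y : ℝ≥0∞, x ≠ ∞ → y ≤ C * x → y.toReal ≤ C.toReal * x.toReal := by
    intro x y hx hxy
    have := ENNReal.toReal_mono (by finiteness) hxy
    rwa [ENNReal.toReal_mul] at this
  have hqf := h.chainMass_ne_top hC
  obtain ⟨φ, hφ⟩ := RandomTree.exists_exp_bounds (q := fun n => (chainMass α n).toReal) ha hCr
    (by simp [chainMass_zero])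
    (fun n => ENNReal.toReal_pos (h.chainMass_ne_zero hc n) (hqf n))
    (fun i j => by
      have := hlow _ _ (hqf _) (h.le_chainMass_add i j)
      rwa [ENNReal.toReal_mul] at this)
    (fun i j => by
      have hf : chainMass α i * chainMass α j ≠ ∞ := ENNReal.mul_ne_top (hqf _) (hqf _)
      have := hup _ _ hf (h.chainMass_add_le i j)
      rwa [ENNReal.toReal_mul] at this)
  refine ⟨φ, fun n => ?_⟩
  have h1 := h.lintegral_iterate_le n m hm
  have h2 := h.le_lintegral_iterate n m hm (by rwa [measure_univ])
  rw [measure_univ, mul_one] at h1 h2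
  have hfin : ∫⁻ b, (transfer α)^[n + 1] 1 b ∂m ≠ ∞ :=
    (h1.trans_lt (ENNReal.mul_lt_top hC.lt_top (hqf n).lt_top)).ne
  refine ⟨hfin, ?_, ?_⟩
  · refine le_trans ?_ (hlow _ _ hfin h2)
    rw [mul_assoc]
    have := (hφ n).1
    gcongr
  · refine (hup _ _ (hqf n) h1).trans ?_
    rw [mul_assoc]
    have := (hφ n).2
    gcongr

end TransferBounds

/-- The second moment of the Green function decays exponentially, with constants that are uniform
in the spectral parameter as long as the moment of order `-3` of the imaginary part is bounded. -/
theorem exists_uniform_exp_bounds {k : ℕ} (hk : 1 ≤ k) {ν : Measure ℝ} [IsProbabilityMeasure ν]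
    {M A L Z B : ℝ≥0∞} (hν : SiteLaw ν M A L) (hM : M ≠ ∞) (hA : A ≠ ∞) (hL : L ≠ ∞)
    (hB : B ≠ ∞) (hZ : Z ≠ ∞) :
    ∃ Cm Cp : ℝ, 0 < Cm ∧ 0 < Cp ∧ ∀ ζ : ℂ, 0 < ζ.im → ‖ζ‖ₑ ≤ Z →
      ∫⁻ V, (ENNReal.ofReal (rootGreen ζ V).im)⁻¹ ^ 3 ∂(fieldLaw (k + 1) ν) ≤ B →
      ∃ φ : ℝ, ∀ x : Vertex (k + 1),
        ∫⁻ V, ‖greenCol V ζ x‖ₑ ^ 2 ∂(fieldLaw (k + 1) ν) ≠ ∞ ∧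
        Cm * Real.exp (φ * x.length)
          ≤ (∫⁻ V, ‖greenCol V ζ x‖ₑ ^ 2 ∂(fieldLaw (k + 1) ν)).toReal ∧
        (∫⁻ V, ‖greenCol V ζ x‖ₑ ^ 2 ∂(fieldLaw (k + 1) ν)).toReal
          ≤ Cp * Real.exp (φ * x.length) := by
  set B₁ : ℝ≥0∞ := M * ENNReal.ofReal Real.pi * B with hB₁
  have hB₁f : B₁ ≠ ∞ := by rw [hB₁]; finiteness
  set B₂ : ℝ≥0∞ := 16 ^ k * (k * B₁) + B with hB₂
  have hB₂f : B₂ ≠ ∞ := by rw [hB₂]; finiteness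
  have hB₁₂ : B₁ ≤ B₂ := by
    refine le_trans ?_ le_self_add
    calc B₁ ≤ k * B₁ := le_mul_of_one_le_left' (by exact_mod_cast hk)
      _ ≤ _ := le_mul_of_one_le_left' (one_le_pow₀ (by norm_num))
  obtain ⟨C, c, R, hC, hc, hR, hBR, hT⟩ := exists_transferBounds hν hM hA hL hB₂f hZ
  set a : ℝ := c.toReal / (4 * (1 + R + R) ^ 2).toReal with ha
  -- if no `ζ` satisfies the moment condition, any constants do
  by_cases hex : ∃ ζ : ℂ, 0 < ζ.im ∧ ‖ζ‖ₑ ≤ Z ∧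
      ∫⁻ V, (ENNReal.ofReal (rootGreen ζ V).im)⁻¹ ^ 3 ∂(fieldLaw (k + 1) ν) ≤ B
  swap
  · exact ⟨1, 1, one_pos, one_pos, fun ζ h1 h2 h3 => (hex ⟨ζ, h1, h2, h3⟩).elim⟩
  have hTB : ∀ ζ : ℂ, 0 < ζ.im → ‖ζ‖ₑ ≤ Z →
      ∫⁻ V, (ENNReal.ofReal (rootGreen ζ V).im)⁻¹ ^ 3 ∂(fieldLaw (k + 1) ν) ≤ B →
      ∫⁻ V, ‖rootGreen ζ V‖ₑ ^ 4 ∂(fieldLaw (k + 1) ν) ≤ B₁ ∧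
      TransferBounds (coeffLaw ν ζ (branchLaw k ν ζ)) C c R := fun ζ hζ hζZ hζB => by
    have h4 : ∫⁻ V, ‖rootGreen ζ V‖ₑ ^ 4 ∂(fieldLaw (k + 1) ν) ≤ B₁ := by
      refine (lintegral_rootGreen_pow_four_le hν hζ).trans ?_
      rw [hB₁]
      gcongr
    exact ⟨h4, hT ζ _ hζ hζZ (isProbabilityMeasure_branchLaw hζ)
      (branchLaw_bounds hk hζ h4 hζB)⟩
  have hpos : 0 < a ∧ 0 < C.toReal := by
    obtain ⟨ζ, hζ, hζZ, hζB⟩ := hex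
    have hσ := isProbabilityMeasure_branchLaw (k := k) (ν := ν) hζ
    have hb := (hTB ζ hζ hζZ hζB).2
    refine ⟨div_pos (ENNReal.toReal_pos hc (hb.c_ne_top hC)) (ENNReal.toReal_pos ?_ (by finiteness)),
      ENNReal.toReal_pos (fun h0 => ?_) hC⟩
    · exact mul_ne_zero (by norm_num) (pow_ne_zero _ (by simp))
    · have h1 := hb.lower 0 (by simp)
      have h2 := hb.upper 0 (by simp)
      rw [h0, nonpos_iff_eq_zero] at h2
      rw [h2, mul_zero, nonpos_iff_eq_zero] at h1
      exact hc h1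
  obtain ⟨ha0, hC0⟩ := hpos
  refine ⟨a * (a / C.toReal), C.toReal * (C.toReal / a), by positivity, by positivity,
    fun ζ hζ hζZ hζB => ?_⟩
  have hσ := isProbabilityMeasure_branchLaw (k := k) (ν := ν) hζ
  have hℓ := isProbabilityMeasure_rootLaw (ν := ν) (k + 1) hζ
  obtain ⟨h4, hb⟩ := hTB ζ hζ hζZ hζB
  have hmom : ∫⁻ s, ‖s‖ₑ ^ 4 ∂(rootLaw (k + 1) ν ζ) ≤ B₂ := by
    rw [rootLaw, lintegral_map (by fun_prop) (measurable_rootGreen hζ)]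
    exact h4.trans hB₁₂
  obtain ⟨φ, hφ⟩ := hb.exists_exp_bounds hC hc hR (rootLaw (k + 1) ν ζ)
    ((ae_im_rootLaw (k + 1) hζ).mono fun _ h => h.le)
    (one_le_two_mul_measure_enorm_le hBR hR _ hmom)
  refine ⟨φ, fun x => ?_⟩
  rw [lintegral_greenCol_sq hζ x]
  exact hφ x.length

/-- The exponential rate is at most `-log K`, because the square of the Green function is summable over
the `K ^ n` vertices at distance `n`. -/
theorem rate_le_neg_log {k : ℕ} {ν : Measure ℝ} [IsProbabilityMeasure ν] {ζ : ℂ} (hζ : 0 < ζ.im)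
    {Cm φ : ℝ} (hCm : 0 < Cm) (h : ∀ x : Vertex (k + 1),
      ∫⁻ V, ‖greenCol V ζ x‖ₑ ^ 2 ∂(fieldLaw (k + 1) ν) ≠ ∞ ∧ Cm * Real.exp (φ * x.length)
        ≤ (∫⁻ V, ‖greenCol V ζ x‖ₑ ^ 2 ∂(fieldLaw (k + 1) ν)).toReal) :
    φ ≤ -Real.log (k + 1 : ℕ) := by
  have hK : (0 : ℝ) < ((k + 1 : ℕ) : ℝ) := by positivity
  have hbound : ∀ n : ℕ, Cm * Real.exp ((φ + Real.log (k + 1 : ℕ)) * n) ≤ (ζ.im⁻¹) ^ 2 := fun n => by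
    have hinj : Function.Injective (fun f : Fin n → Fin (k + 1) => List.ofFn f) :=
      List.ofFn_injective
    have h1 : ∑ f : Fin n → Fin (k + 1),
        ∫⁻ V, ‖greenCol V ζ (List.ofFn f)‖ₑ ^ 2 ∂(fieldLaw (k + 1) ν)
          ≤ ENNReal.ofReal ((ζ.im⁻¹) ^ 2) := by
      rw [← lintegral_finsetSum _ (fun f _ => by
        have := measurable_greenCol (K := k + 1) hζ (List.ofFn f)
        fun_prop)]
      calc _ ≤ ∫⁻ _ : Vertex (k + 1) → ℝ, ENNReal.ofReal ((ζ.im⁻¹) ^ 2) ∂(fieldLaw (k + 1) ν) := by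
            refine lintegral_mono fun V => ?_
            have h2 := sum_norm_sq_greenCol_le V ζ hζ
              (Finset.univ.map ⟨fun f : Fin n → Fin (k + 1) => List.ofFn f, hinj⟩)
            rw [Finset.sum_map] at h2
            refine le_trans (le_of_eq ?_) (ENNReal.ofReal_le_ofReal h2)
            rw [ENNReal.ofReal_sum_of_nonneg (fun _ _ => by positivity)]
            refine Finset.sum_congr rfl fun f _ => ?_
            rw [ENNReal.ofReal_pow (norm_nonneg _), ofReal_norm]
            rfl
        _ = _ := by simp
    have h3 : ∑ f : Fin n → Fin (k + 1),
        (∫⁻ V, ‖greenCol V ζ (List.ofFn f)‖ₑ ^ 2 ∂(fieldLaw (k + 1) ν)).toReal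
          ≤ (ζ.im⁻¹) ^ 2 := by
      rw [← ENNReal.toReal_sum fun f _ => (h _).1]
      exact ENNReal.toReal_le_of_le_ofReal (by positivity) h1
    calc Cm * Real.exp ((φ + Real.log (k + 1 : ℕ)) * n)
        = ∑ _f : Fin n → Fin (k + 1), Cm * Real.exp (φ * n) := by
          rw [Finset.sum_const, Finset.card_univ, Fintype.card_fun, Fintype.card_fin,
            Fintype.card_fin, nsmul_eq_mul, add_mul, Real.exp_add, mul_comm (Real.log _),
            Real.exp_nat_mul, Real.exp_log hK]
          push_cast
          ring
      _ ≤ _ := by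
          refine le_trans (Finset.sum_le_sum fun f _ => ?_) h3
          have := (h (List.ofFn f)).2
          rwa [List.length_ofFn] at this
  by_contra! hcon
  have hs : 0 < φ + Real.log (k + 1 : ℕ) := by linarith
  have hlim : Tendsto (fun n : ℕ => Cm * Real.exp ((φ + Real.log (k + 1 : ℕ)) * n)) atTop atTop :=
    (Real.tendsto_exp_atTop.comp
      (tendsto_natCast_atTop_atTop.const_mul_atTop hs)).const_mul_atTop hCm
  obtain ⟨n, hn⟩ := (hlim.eventually_gt_atTop ((ζ.im⁻¹) ^ 2)).exists
  exact absurd (hbound n) (not_le.2 hn)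

end

section

/-! ### Distance to the root -/

theorem length_le_length_walk {K : ℕ} {x y : Vertex K} (p : (tree K).Walk x y) :
    y.length ≤ x.length + p.length := by
  induction p with
  | nil => simp
  | cons h p ih =>
    rw [SimpleGraph.Walk.length_cons]
    rcases h with ⟨i, rfl⟩ | ⟨i, rfl⟩
    · rw [List.length_cons] at ih; omega
    · rw [List.length_cons]; omega

theorem exists_walk_length_eq {K : ℕ} (x : Vertex K) :
    ∃ p : (tree K).Walk (root K) x, p.length = x.length := by
  induction x with
  | nil => exact ⟨SimpleGraph.Walk.nil, rfl⟩
  | cons i t ih =>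
    obtain ⟨p, hp⟩ := ih
    have hadj : (tree K).Adj t (i :: t) := Or.inl ⟨i, rfl⟩
    exact ⟨p.concat hadj, by rw [SimpleGraph.Walk.length_concat, hp, List.length_cons]⟩

theorem depth_eq_length {K : ℕ} (x : Vertex K) : depth x = x.length := by
  obtain ⟨p, hp⟩ := exists_walk_length_eq x
  refine le_antisymm ((SimpleGraph.dist_le p).trans hp.le) ?_
  obtain ⟨p', hp'⟩ := (SimpleGraph.Walk.reachable p).exists_walk_length_eq_dist
  have := length_le_length_walk p'
  rw [hp'] at this
  simpa [depth] using this

instance depthAtTop_neBot (k : ℕ) : (depthAtTop (k + 1)).NeBot := by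
  refine atTop_neBot.comap_of_surj fun n => ⟨List.replicate n 0, ?_⟩
  rw [depth_eq_length, List.length_replicate]

/-! ### The single-site law of an admissible density -/

/-- Only balls of radius one are needed from the local condition on the density. -/
theorem exists_siteLaw {ρ : ℝ → ℝ} (hρ : IsAdmissibleDensity ρ) {ν : Measure ℝ}
    [IsProbabilityMeasure ν] (hν : ν = volume.withDensity fun v => ENNReal.ofReal (ρ v)) :
    ∃ M A L : ℝ≥0∞, M ≠ ∞ ∧ A ≠ ∞ ∧ L ≠ ∞ ∧ SiteLaw ν M A L := by
  obtain ⟨M, hM⟩ := hρ.bounded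
  obtain ⟨c, hc⟩ := hρ.local_bound
  have hmeas := hρ.measurable
  have hint : Integrable ρ := by
    refine ⟨hmeas.aestronglyMeasurable, ?_⟩
    rw [hasFiniteIntegral_iff_ofReal (Filter.Eventually.of_forall hρ.nonneg)]
    have h1 := measure_univ (μ := ν)
    rw [hν, withDensity_apply _ MeasurableSet.univ, setLIntegral_univ] at h1
    rw [h1]; norm_num
  have htight : ∃ n : ℕ, 1 ≤ 2 * ν {v | ‖v‖ₑ ≤ (n : ℝ≥0∞)} := by
    have hmono : Monotone fun n : ℕ => {v : ℝ | ‖v‖ₑ ≤ (n : ℝ≥0∞)} := fun m n hmn v hv =>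
      le_trans (α := ℝ≥0∞) hv (by exact_mod_cast hmn)
    have hunion : ⋃ n : ℕ, {v : ℝ | ‖v‖ₑ ≤ (n : ℝ≥0∞)} = univ := by
      rw [eq_univ_iff_forall]
      intro v
      obtain ⟨n, hn⟩ := ENNReal.exists_nat_gt (enorm_ne_top (x := v))
      exact mem_iUnion.2 ⟨n, hn.le⟩
    have hlim := tendsto_measure_iUnion_atTop (μ := ν) hmono
    rw [hunion, measure_univ] at hlim
    obtain ⟨n, hn⟩ := (hlim.eventually_const_le (u := 2⁻¹) (by
      rw [ENNReal.inv_lt_one]; norm_num)).exists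
    refine ⟨n, ?_⟩
    calc (1 : ℝ≥0∞) = 2 * 2⁻¹ := (ENNReal.mul_inv_cancel (by norm_num) (by norm_num)).symm
      _ ≤ _ := mul_le_mul_right hn _
  obtain ⟨n, hn⟩ := htight
  refine ⟨ENNReal.ofReal M, ENNReal.ofReal (|c| * 2⁻¹), n, by finiteness, by finiteness,
    by finiteness, ⟨_, by fun_prop, hν, ?_, ?_⟩, hn⟩
  · filter_upwards [hM] with v hv
    exact ENNReal.ofReal_le_ofReal hv
  · filter_upwards [hc] with v hv
    have h1 := hv 1 ⟨by norm_num, le_rfl⟩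
    have h2 : 0 ≤ ∫ v' in Metric.ball v 1, ρ v' := integral_nonneg hρ.nonneg
    rw [hν, withDensity_apply _ measurableSet_ball,
      ← ofReal_integral_eq_lintegral_ofReal hint.integrableOn
        (Filter.Eventually.of_forall hρ.nonneg), ← ENNReal.ofReal_mul (by positivity)]
    refine ENNReal.ofReal_le_ofReal (h1.trans ?_)
    rw [mul_one, ← mul_assoc]
    gcongr
    exact le_abs_self c

/-! ### Transfer of the moment hypothesis -/

theorem inv_pow_three_le (y : ℝ≥0∞) {δ : ℝ} (hδ : 0 < δ) : y⁻¹ ^ 3 ≤ 1 + y ^ (-3 - δ) := by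
  rcases le_total y⁻¹ 1 with h | h
  · exact (pow_le_one₀ zero_le h).trans le_self_add
  · refine le_trans ?_ le_add_self
    rw [show -3 - δ = -(3 + δ) by ring, ENNReal.rpow_neg, ← ENNReal.inv_rpow,
      ← ENNReal.rpow_natCast]
    exact ENNReal.rpow_le_rpow_of_exponent_le h (by push_cast; linarith)

/-- By Fatou's lemma, a bound on the integrals of a continuous family of functions that holds for
almost all `η ∈ (0, 1]` holds for all of them. -/
theorem lintegral_le_of_ae_of_continuousOn {X : Type*} [MeasurableSpace X] {m : Measure X}
    {f : ℝ → X → ℝ≥0∞} {B : ℝ≥0∞} (hf : ∀ η, 0 < η → Measurable (f η))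
    (hc : ∀ x, ContinuousOn (fun η => f η x) (Ioi 0))
    (h : ∀ᵐ η : ℝ, η ∈ Ioc (0 : ℝ) 1 → ∫⁻ x, f η x ∂m ≤ B) {η : ℝ} (hη : η ∈ Ioc (0 : ℝ) 1) :
    ∫⁻ x, f η x ∂m ≤ B := by
  have hdense := Measure.dense_of_ae h
  have hη2 : η / 2 < η := half_lt_self hη.1
  have hmem : η ∈ closure (Ioo (η / 2) η ∩
      {η : ℝ | η ∈ Ioc (0 : ℝ) 1 → ∫⁻ x, f η x ∂m ≤ B}) := by
    rw [← closure_closure]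
    refine closure_mono (hdense.open_subset_closure_inter isOpen_Ioo) ?_
    rw [closure_Ioo hη2.ne]
    exact ⟨hη2.le, le_rfl⟩
  obtain ⟨t, ht, htlim⟩ := mem_closure_iff_seq_limit.1 hmem
  have htpos : ∀ n, 0 < t n := fun n => (half_pos hη.1).trans (ht n).1.1
  have hle : ∀ n, ∫⁻ x, f (t n) x ∂m ≤ B := fun n =>
    (ht n).2 ⟨htpos n, (ht n).1.2.le.trans hη.2⟩
  have hconv : ∀ x, Tendsto (fun n => f (t n) x) atTop (𝓝 (f η x)) := fun x =>
    ((hc x).continuousAt (Ioi_mem_nhds hη.1)).tendsto.comp htlim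
  calc ∫⁻ x, f η x ∂m = ∫⁻ x, liminf (fun n => f (t n) x) atTop ∂m :=
        lintegral_congr fun x => (hconv x).liminf_eq.symm
    _ ≤ liminf (fun n => ∫⁻ x, f (t n) x ∂m) atTop :=
        lintegral_liminf_le fun n => hf _ (htpos n)
    _ ≤ liminf (fun _ : ℕ => B) atTop := liminf_le_liminf (Filter.Eventually.of_forall hle)
    _ = B := liminf_const B

theorem continuousOn_rootGreen {K : ℕ} (E : ℝ) (V : Vertex K → ℝ) :
    ContinuousOn (fun η : ℝ => rootGreen (E + η * Complex.I : ℂ) V) (Ioi 0) := by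
  have him : ∀ t : ℝ, (E + t * Complex.I : ℂ).im = t := fun t => by simp
  intro η hη
  have hη0 : 0 < η / 2 := half_pos hη
  have hc : Continuous fun s : Ici (η / 2) =>
      (greenCol V (E + (s : ℝ) * Complex.I : ℂ) : Vertex K → ℂ) :=
    continuous_greenCol (v := fun _ => V) (z := fun s : Ici (η / 2) =>
      (E + (s : ℝ) * Complex.I : ℂ)) continuous_const (by fun_prop) hη0
      (fun s => by rw [him]; exact s.2)
  have h1 : ContinuousOn (fun η : ℝ => rootGreen (E + η * Complex.I : ℂ) V) (Ici (η / 2)) :=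
    continuousOn_iff_continuous_domRestrict.2 ((continuous_apply (root K)).comp hc)
  exact (h1.continuousAt (Ici_mem_nhds (half_lt_self hη))).continuousWithinAt

theorem lintegral_inv_im_le_of_ae {K : ℕ} {ν : Measure ℝ} [IsProbabilityMeasure ν] {E : ℝ}
    {B : ℝ≥0∞} (h : ∀ᵐ η : ℝ, η ∈ Ioc (0 : ℝ) 1 →
      ∫⁻ V, (ENNReal.ofReal (rootGreen (E + η * Complex.I : ℂ) V).im)⁻¹ ^ 3 ∂(fieldLaw K ν) ≤ B)
    {η : ℝ} (hη : η ∈ Ioc (0 : ℝ) 1) :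
    ∫⁻ V, (ENNReal.ofReal (rootGreen (E + η * Complex.I : ℂ) V).im)⁻¹ ^ 3 ∂(fieldLaw K ν) ≤ B := by
  refine lintegral_le_of_ae_of_continuousOn
    (f := fun η V => (ENNReal.ofReal (rootGreen (E + η * Complex.I : ℂ) V).im)⁻¹ ^ 3)
    (fun η hη => ?_) (fun V => ?_) h hη
  · have := measurable_rootGreen (K := K) (ζ := (E + η * Complex.I : ℂ)) (by simpa using hη)
    fun_prop
  · have h1 : Continuous fun w : ℂ => (ENNReal.ofReal w.im)⁻¹ ^ 3 :=
      (ENNReal.continuous_pow 3).comp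
        (continuous_inv.comp (ENNReal.continuous_ofReal.comp Complex.continuous_im))
    exact h1.comp_continuousOn (continuousOn_rootGreen E V)

/-- Fubini's theorem for a property that holds almost everywhere on a strip. -/
theorem ae_ae_of_ae_reProdIm {I : Set ℝ} (hI : MeasurableSet I) {p : ℂ → Prop}
    (h : ∀ᵐ ζ ∂(volume.restrict (I ×ℂ Ioc (0 : ℝ) 1)), p ζ) :
    ∀ᵐ E : ℝ ∂(volume.restrict I), ∀ᵐ η : ℝ, η ∈ Ioc (0 : ℝ) 1 → p (E + η * Complex.I) := by
  have hm : MeasurableSet (I ×ℂ Ioc (0 : ℝ) 1) :=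
    (Complex.measurable_re hI).inter (Complex.measurable_im measurableSet_Ioc)
  rw [ae_restrict_iff' hm] at h
  have h1 := Complex.volume_preserving_equiv_real_prod.symm.quasiMeasurePreserving.ae h
  rw [ae_restrict_iff' hI]
  have h2 := Measure.ae_ae_of_ae_prod h1
  filter_upwards [h2] with E hE hEI
  filter_upwards [hE] with η hη hηI
  have e : Complex.measurableEquivRealProd.symm (E, η) = E + η * Complex.I := by
    rw [Complex.measurableEquivRealProd_symm_apply, Complex.mk_eq_add_mul_I]
  rw [e] at hη
  exact hη (by rw [Complex.mem_reProdIm]; simpa using ⟨hEI, hηI⟩)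

/-- The free energy exists as soon as the moments have two-sided exponential bounds. -/
theorem tendsto_log_div_depth {k : ℕ} {g : Vertex (k + 1) → ℝ} {Cm Cp φ : ℝ} (hCm : 0 < Cm)
    (hCp : 0 < Cp) (h : ∀ x, Cm * Real.exp (φ * depth x) ≤ g x ∧ g x ≤ Cp * Real.exp (φ * depth x)) :
    Tendsto (fun x => Real.log (g x) / (depth x : ℝ)) (depthAtTop (k + 1)) (𝓝 φ) := by
  have hd : Tendsto (depth : Vertex (k + 1) → ℕ) (depthAtTop (k + 1)) atTop := tendsto_comap
  have hc : ∀ C : ℝ, Tendsto (fun x : Vertex (k + 1) => Real.log C / (depth x : ℝ) + φ)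
      (depthAtTop (k + 1)) (𝓝 φ) := fun C => by
    have := ((tendsto_const_div_atTop_nhds_zero_nat (Real.log C)).comp hd).add_const φ
    rwa [zero_add] at this
  have hpos : ∀ᶠ x : Vertex (k + 1) in depthAtTop (k + 1), 0 < depth x :=
    hd.eventually (eventually_gt_atTop 0)
  have hlog : ∀ (C : ℝ), 0 < C → ∀ x : Vertex (k + 1), 0 < depth x →
      Real.log (C * Real.exp (φ * depth x)) / (depth x : ℝ) = Real.log C / (depth x : ℝ) + φ := by
    intro C hC x hx
    have hx' : (depth x : ℝ) ≠ 0 := by exact_mod_cast hx.ne'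
    rw [Real.log_mul hC.ne' (Real.exp_pos _).ne', Real.log_exp, add_div, mul_div_cancel_right₀ _ hx']
  refine tendsto_of_tendsto_of_tendsto_of_le_of_le' (hc Cm) (hc Cp) ?_ ?_
  · filter_upwards [hpos] with x hx
    rw [← hlog Cm hCm x hx]
    have := Real.log_le_log (by positivity) (h x).1
    gcongr
  · filter_upwards [hpos] with x hx
    rw [← hlog Cp hCp x hx]
    have h0 : 0 < g x := lt_of_lt_of_le (by positivity) (h x).1
    have := Real.log_le_log h0 (h x).2
    gcongr

/-- A random potential as a field with the law `fieldLaw`. -/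
theorem map_field_eq {K : ℕ} {Ω : Type*} [MeasurableSpace Ω] {P : Measure Ω}
    [IsProbabilityMeasure P] {ρ : ℝ → ℝ} {V : Vertex K → Ω → ℝ} (hV : IsIIDPotential P V ρ)
    {ν : Measure ℝ} [IsProbabilityMeasure ν]
    (hν : ν = volume.withDensity fun v => ENNReal.ofReal (ρ v)) :
    P.map (fun ω x => V x ω) = fieldLaw K ν := by
  rw [hV.indep.map_fun_eq_infinitePi_map hV.measurable, fieldLaw]
  congr 1
  funext x
  rw [hV.law, hν]

theorem greenMoment_two_eq {K : ℕ} {Ω : Type*} [MeasurableSpace Ω] {P : Measure Ω}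
    {V : Vertex K → Ω → ℝ} (hV : ∀ x, Measurable (V x)) {ν : Measure ℝ} [IsProbabilityMeasure ν]
    (hmap : P.map (fun ω x => V x ω) = fieldLaw K ν) {ζ : ℂ} (hζ : 0 < ζ.im) (x : Vertex K) :
    greenMoment P V 2 ζ x = (∫⁻ W, ‖greenCol W ζ x‖ₑ ^ 2 ∂(fieldLaw K ν)).toReal := by
  have hc := measurable_greenCol (K := K) hζ x
  have hVm : Measurable fun ω x => V x ω := measurable_pi_lambda _ hV
  have hg : ∀ ω, randomGreen V (root K) x ζ ω = greenCol (fun z => V z ω) ζ x := fun ω =>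
    green_root_eq _ ζ hζ x
  have hgm : Measurable fun ω => greenCol (fun z => V z ω) ζ x := hc.comp hVm
  rw [greenMoment]
  simp_rw [hg, Real.rpow_two]
  rw [integral_eq_lintegral_of_nonneg_ae (Filter.Eventually.of_forall fun ω => by positivity)
    (hgm.norm.pow_const 2).aestronglyMeasurable, ← hmap, lintegral_map (by fun_prop) hVm]
  congr 1
  refine lintegral_congr fun ω => ?_
  rw [ENNReal.ofReal_pow (norm_nonneg _), ofReal_norm]

end

end RandomTree

end

theorem theorem2 (K : ℕ) (hK : 2 ≤ K) {Ω : Type*} [MeasurableSpace Ω] (P : Measure Ω)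
    [IsProbabilityMeasure P] (ρ : ℝ → ℝ) (hρ : IsAdmissibleDensity ρ)
    (V : Vertex K → Ω → ℝ) (hV : IsIIDPotential P V ρ)
    (I : Set ℝ) (hI : MeasurableSet I) (hIb : Bornology.IsBounded I)
    (δ : ℝ) (hδ : 0 < δ)
    (hmom : essSup
      (fun ζ : ℂ => ∫⁻ ω, ENNReal.ofReal (randomGreen V (root K) (root K) ζ ω).im ^ (-3 - δ) ∂P)
      (volume.restrict (I ×ℂ Ioc (0 : ℝ) 1)) < ∞) :
    ∃ Cm Cp : ℝ, 0 < Cm ∧ 0 < Cp ∧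
      ∀ᵐ E : ℝ ∂(volume.restrict I), ∀ η ∈ Ioc (0 : ℝ) 1, ∀ ζ : ℂ, ζ = E + η * Complex.I →
        Tendsto (logMomentRate P V 2 ζ) (depthAtTop K) (𝓝 (freeEnergy P V 2 ζ)) ∧
        (∀ x : Vertex K,
          Cm * Real.exp (freeEnergy P V 2 ζ * depth x) ≤ greenMoment P V 2 ζ x ∧
          greenMoment P V 2 ζ x ≤ Cp * Real.exp (freeEnergy P V 2 ζ * depth x)) ∧
        freeEnergy P V 2 ζ ≤ -Real.log K ∧
        ∀ x : Vertex K, greenMoment P V 2 ζ x ≤ Cp * ((K : ℝ) ^ depth x)⁻¹ := by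
  obtain ⟨k, rfl⟩ : ∃ k, K = k + 1 := ⟨K - 1, by omega⟩
  have hk : 1 ≤ k := by omega
  set ν : Measure ℝ := volume.withDensity fun v => ENNReal.ofReal (ρ v) with hν
  have : IsProbabilityMeasure ν := by
    rw [hν, ← hV.law (root _)]
    exact Measure.isProbabilityMeasure_map (hV.measurable _).aemeasurable
  have hmap := map_field_eq hV hν
  have hVm : Measurable fun ω x => V x ω := measurable_pi_lambda _ hV.measurable
  obtain ⟨M, A, L, hM, hA, hL, hsite⟩ := exists_siteLaw hρ hν
  obtain ⟨r, hr⟩ := hIb.exists_norm_le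
  set B := essSup
      (fun ζ : ℂ => ∫⁻ ω, ENNReal.ofReal
        (randomGreen V (root (k + 1)) (root (k + 1)) ζ ω).im ^ (-3 - δ) ∂P)
      (volume.restrict (I ×ℂ Ioc (0 : ℝ) 1)) with hB
  obtain ⟨Cm, Cp, hCm, hCp, huni⟩ := exists_uniform_exp_bounds (B := 1 + B)
    (Z := ENNReal.ofReal (r + 1)) hk hsite hM hA hL (by finiteness) (by finiteness)
  refine ⟨Cm, Cp, hCm, hCp, ?_⟩
  have hae := ae_ae_of_ae_reProdIm hI (ENNReal.ae_le_essSup (μ := volume.restrict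
    (I ×ℂ Ioc (0 : ℝ) 1)) fun ζ : ℂ => ∫⁻ ω, ENNReal.ofReal
      (randomGreen V (root (k + 1)) (root (k + 1)) ζ ω).im ^ (-3 - δ) ∂P)
  filter_upwards [hae, ae_restrict_mem hI] with E hE hEI η hη ζ hζe
  have him : ∀ t : ℝ, (E + t * Complex.I : ℂ).im = t := fun t => by simp
  have hinv : ∫⁻ W, (ENNReal.ofReal (rootGreen (E + η * Complex.I : ℂ) W).im)⁻¹ ^ 3
      ∂(fieldLaw (k + 1) ν) ≤ 1 + B := by
    refine lintegral_inv_im_le_of_ae ?_ hη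
    filter_upwards [hE] with t ht htI
    have htp : 0 < (E + t * Complex.I : ℂ).im := by rw [him]; exact htI.1
    have hg := measurable_rootGreen (K := k + 1) htp
    calc _ ≤ ∫⁻ W, (1 + ENNReal.ofReal (rootGreen (E + t * Complex.I : ℂ) W).im ^ (-3 - δ))
          ∂(fieldLaw (k + 1) ν) := lintegral_mono fun W => inv_pow_three_le _ hδ
      _ = 1 + ∫⁻ ω, ENNReal.ofReal (randomGreen V (root (k + 1)) (root (k + 1))
          (E + t * Complex.I : ℂ) ω).im ^ (-3 - δ) ∂P := by
          rw [lintegral_add_left measurable_const, lintegral_const, measure_univ, mul_one, ← hmap,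
            lintegral_map (by fun_prop) hVm]
          congr 1
          refine lintegral_congr fun ω => ?_
          rw [randomGreen, green_root_eq _ _ htp]
          rfl
      _ ≤ 1 + B := by gcongr; exact ht htI
  rw [← hζe] at hinv
  have hζ : 0 < ζ.im := by rw [hζe, him]; exact hη.1
  have hζZ : ‖ζ‖ₑ ≤ ENNReal.ofReal (r + 1) := by
    rw [← ofReal_norm, hζe]
    refine ENNReal.ofReal_le_ofReal ((norm_add_le _ _).trans ?_)
    rw [norm_mul, Complex.norm_I, mul_one, Complex.norm_real, Complex.norm_real,
      Real.norm_of_nonneg hη.1.le]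
    exact add_le_add (hr E hEI) hη.2
  obtain ⟨φ, hφ⟩ := huni ζ hζ hζZ hinv
  have hbd : ∀ x : Vertex (k + 1), Cm * Real.exp (φ * depth x) ≤ greenMoment P V 2 ζ x ∧
      greenMoment P V 2 ζ x ≤ Cp * Real.exp (φ * depth x) := fun x => by
    rw [greenMoment_two_eq hV.measurable hmap hζ, depth_eq_length]
    exact (hφ x).2
  have hlim : Tendsto (logMomentRate P V 2 ζ) (depthAtTop (k + 1)) (𝓝 φ) :=
    tendsto_log_div_depth hCm hCp hbd
  have hfree : freeEnergy P V 2 ζ = φ := hlim.limUnder_eq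
  have hrate : φ ≤ -Real.log (k + 1 : ℕ) :=
    rate_le_neg_log hζ hCm fun x => ⟨(hφ x).1, (hφ x).2.1⟩
  rw [hfree]
  refine ⟨hlim, hbd, hrate, fun x => (hbd x).2.trans ?_⟩
  have hKpos : (0 : ℝ) < ((k + 1 : ℕ) : ℝ) := by positivity
  have e : Real.exp (-Real.log (k + 1 : ℕ) * depth x) = (((k + 1 : ℕ) : ℝ) ^ depth x)⁻¹ := by
    rw [mul_comm, Real.exp_nat_mul, Real.exp_neg, Real.exp_log hKpos, inv_pow]
  rw [← e]
  gcongr
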